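/- Let $n\geq 1$ and let $\boldsymbol{W}=\{\boldsymbol{W}_t : t\geq 0\}$ be Brownian motion in $\mathbb{R}^n$ starting at the origin, that is, its $n$ coordinate processes are independent standard one-dimensional Brownian motions. Let $\mathcal{H}_1$ be the convex hull of the path $\{\boldsymbol{W}_s : 0\leq s\leq 1\}$, and let $R_1$ be its circumradius, i.e. the smallest radius of a closed Euclidean ball in $\mathbb{R}^n$ containing $\mathcal{H}_1$. Then $R_1$ is integrable and $$\frac{1}{2}\sqrt{n}\;\leq\;\mathbb{E}[R_1]\;\leq\;\sqrt{\log 2}\,\sqrt{n}.$$ -/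

import Mathlib

open MeasureTheory ProbabilityTheory
open scoped NNReal

/-- `W` is a Brownian motion in `ℝⁿ` started at the origin, under the measure `P`: its coordinate
processes are standard one-dimensional Brownian motions (with almost surely continuous paths,
vanishing almost surely at time `0`), and these `n` processes are mutually independent. -/
structure IsBrownianMotion {Ω : Type*} [MeasurableSpace Ω] {n : ℕ}
    (W : ℝ≥0 → Ω → EuclideanSpace ℝ (Fin n)) (P : Measure Ω) : Prop where
  isBrownianReal_coord : ∀ j : Fin n, IsBrownianReal (fun t ω => W t ω j) P
  iIndepFun_coord : iIndepFun (fun (j : Fin n) (ω : Ω) (t : ℝ≥0) => W t ω j) P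

/-- The convex hull of the path of `W` run up to time `t`, for the outcome `ω`. -/
def pathHull {Ω : Type*} {n : ℕ} (W : ℝ≥0 → Ω → EuclideanSpace ℝ (Fin n)) (t : ℝ≥0) (ω : Ω) :
    Set (EuclideanSpace ℝ (Fin n)) :=
  convexHull ℝ ((fun s => W s ω) '' Set.Icc 0 t)

/-- The circumradius of a nonempty bounded subset of `ℝⁿ`: the smallest radius of a closed
Euclidean ball, with arbitrary center, that contains the set. -/
noncomputable def circumradius {n : ℕ} (K : Set (EuclideanSpace ℝ (Fin n))) : ℝ :=
  sInf {r : ℝ | 0 ≤ r ∧ ∃ c : EuclideanSpace ℝ (Fin n), K ⊆ Metric.closedBall c r}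

open scoped ENNReal

/-! Upper bound. The path lies in the box spanned by the coordinate ranges, so `R₁ ^ 2` is at most a
quarter of the sum of the squared ranges. The mean squared range of a linear Brownian motion on `[0,
1]` is at most `4 * log 2`, so `E[R₁ ^ 2] ≤ n * log 2`, and `E[R₁] ≤ √(E[R₁ ^ 2])` finishes. The
range bound is proved for Gaussian walks on grids, then passed to the limit. With `M` and `m` the
maxima of the positive parts of `X` and `-X`, one-sided reflection bounds `E[M ^ 2] + E[m ^ 2]` by
`2 * E[X_N ^ 2]`. Two-sided reflection bounds `P(M ≥ a, m ≥ b)` by `2 * P(X_N ∈ reflectionBand a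
b)`. Integrated over `a, b > 0`, this turns `E[M * m]` into an area, a series of triangle
differences that sums to `(2 * log 2 - 1) / 2` times the square of the end point.

Lower bound. The path starts at `0`, so a ball containing it has radius at least half of `sup ‖W‖`.
Let `T` be the exit time from the ball of radius `√n`. By Brownian scaling `sup ‖W‖` over `[0, 1]`
has the law of `√(n / T)`. The martingale `‖W t‖ ^ 2 - n * t` gives `E[T] = 1`, and convexity gives
`E[T ^ (-1/2)] ≥ 1`. Here `T` is replaced by sums of indicators over a grid of `[0, 3]`, convexity
by the tangent `3/2 - x/2` of `x ^ (-1/2)` at `1`, and the overshoot at the exit is controlled by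
fourth moments. -/

/-! ### Reflection inequalities for a single Gaussian law -/

/-- Points of `[a, ∞)` are at least as close to `y` as to its mirror image `2 * a - y`, so the
densities compare pointwise. Variance `0` is included because the increment from time `N` to itself
is degenerate. -/
theorem gaussianReal_reflect_le {a y : ℝ} (v : ℝ≥0) (hy : a ≤ y) {C : Set ℝ}
    (hC : MeasurableSet C) (hCa : C ⊆ Set.Ici a) :
    gaussianReal (2 * a - y) v C ≤ gaussianReal y v C := by
  by_cases hv : v = 0
  · subst hv
    rw [gaussianReal_zero_var, gaussianReal_zero_var, Measure.dirac_apply' _ hC,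
      Measure.dirac_apply' _ hC]
    by_cases h : 2 * a - y ∈ C
    · have h1 : a ≤ 2 * a - y := hCa h
      have h2 : 2 * a - y = y := by linarith
      rw [h2]
    · simp [h]
  · rw [gaussianReal_apply _ hv, gaussianReal_apply _ hv]
    refine setLIntegral_mono (by fun_prop) fun x hx => ?_
    have hxa : a ≤ x := hCa hx
    unfold gaussianPDF gaussianPDFReal
    refine ENNReal.ofReal_le_ofReal ?_
    have h : (x - y) ^ 2 ≤ (x - (2 * a - y)) ^ 2 := by
      nlinarith [mul_nonneg (sub_nonneg.2 hxa) (sub_nonneg.2 hy)]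
    gcongr ?_ * Real.exp (?_ / ?_)
    linarith

theorem gaussianReal_preimage_reflect (a y : ℝ) (v : ℝ≥0) {C : Set ℝ} (hC : MeasurableSet C) :
    gaussianReal y v ((fun x => 2 * a - x) ⁻¹' C) = gaussianReal (2 * a - y) v C := by
  rw [← Measure.map_apply (by fun_prop) hC]
  have := gaussianReal_map_const_sub (μ := y) (v := v) (2 * a)
  rw [this]

/-- The points whose residue modulo `2 * (a + b)` lies in `[-b, a]`, excluding `[-b, a]` itself. -/
def reflectionBand (a b : ℝ) : Set ℝ :=
  {x | ∃ i : ℤ, i ≠ 0 ∧ 2 * i * (a + b) - b ≤ x ∧ x ≤ 2 * i * (a + b) + a}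

theorem measurableSet_reflectionBand (a b : ℝ) : MeasurableSet (reflectionBand a b) := by
  have : reflectionBand a b = ⋃ i : {i : ℤ // i ≠ 0},
      Set.Icc (2 * (i : ℤ) * (a + b) - b) (2 * (i : ℤ) * (a + b) + a) := by
    ext x; simp only [reflectionBand, Set.mem_ofPred_eq, Set.mem_iUnion, Set.mem_Icc, Subtype.exists, exists_prop]
  rw [this]
  exact MeasurableSet.iUnion fun _ => measurableSet_Icc

theorem neg_mem_reflectionBand {a b x : ℝ} :
    -x ∈ reflectionBand a b ↔ x ∈ reflectionBand b a := by
  constructor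
  · rintro ⟨i, hi, h1, h2⟩
    refine ⟨-i, by simpa using hi, ?_, ?_⟩ <;> push_cast <;> linarith
  · rintro ⟨i, hi, h1, h2⟩
    refine ⟨-i, by simpa using hi, ?_, ?_⟩ <;> push_cast <;> linarith

/-- Modulo `2 * (a + b)`, the interval `[-b, a]` and its mirror image in `a` cover a full period;
the reflection therefore sends the gaps of the band into translates of `[-b, a]`. -/
theorem reflect_mem_reflectionBand {a b x : ℝ} (ha : 0 < a) (hb : 0 < b) (hx : x ≤ -b)
    (hxB : x ∉ reflectionBand a b) : 2 * a - x ∈ reflectionBand a b := by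
  set i : ℤ := ⌊(x + b) / (2 * (a + b))⌋ with hi
  have hL : 0 < 2 * (a + b) := by linarith
  have h1 : (i : ℝ) * (2 * (a + b)) ≤ x + b := by
    have := Int.floor_le ((x + b) / (2 * (a + b)))
    rwa [← hi, le_div_iff₀ hL] at this
  have h2 : x + b < ((i : ℝ) + 1) * (2 * (a + b)) := by
    have := Int.lt_floor_add_one ((x + b) / (2 * (a + b)))
    rwa [← hi, div_lt_iff₀ hL] at this
  have hi0 : i ≤ 0 := by
    by_contra h
    have : (1 : ℝ) ≤ i := by exact_mod_cast (by omega : (1 : ℤ) ≤ i)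
    nlinarith
  rcases hi0.lt_or_eq with hneg | h0
  · have h3 : 2 * (i : ℝ) * (a + b) + a < x := by
      by_contra h
      exact hxB ⟨i, hneg.ne, by linarith, by linarith⟩
    refine ⟨-i, by omega, ?_, ?_⟩ <;> push_cast <;> linarith
  -- Only `x = -b` is left: it lies in the omitted interval of index `0`, and its image `2 * a + b`
  -- is the left end of the interval of index `1`.
  · rw [h0] at h1 h2
    refine ⟨1, one_ne_zero, ?_, ?_⟩ <;> push_cast at * <;> linarith

/-- Points below `-b` that are in the band are kept; the others are reflected in `a` onto band
points above `a`, which gains mass since the centre is at least `a`. The two target pieces are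
disjoint because `-b < a`. -/
theorem gaussianReal_Iic_le_reflectionBand {a b y : ℝ} (v : ℝ≥0) (ha : 0 < a) (hb : 0 < b)
    (hy : a ≤ y) :
    gaussianReal y v (Set.Iic (-b)) ≤ gaussianReal y v (reflectionBand a b) := by
  have hB := measurableSet_reflectionBand a b
  have hC : MeasurableSet (reflectionBand a b ∩ Set.Ici a) := hB.inter measurableSet_Ici
  have hsub : Set.Iic (-b) ⊆ (reflectionBand a b ∩ Set.Iic (-b)) ∪
      (fun x => 2 * a - x) ⁻¹' (reflectionBand a b ∩ Set.Ici a) := by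
    intro x hx
    by_cases h : x ∈ reflectionBand a b
    · exact Or.inl ⟨h, hx⟩
    · refine Or.inr ⟨reflect_mem_reflectionBand ha hb hx h, ?_⟩
      have : x ≤ -b := hx
      simp only [Set.mem_Ici]; linarith
  calc gaussianReal y v (Set.Iic (-b))
      ≤ _ := measure_mono hsub
    _ ≤ _ := measure_union_le _ _
    _ ≤ gaussianReal y v (reflectionBand a b ∩ Set.Iic (-b)) +
        gaussianReal y v (reflectionBand a b ∩ Set.Ici a) := by
      refine add_le_add le_rfl ?_
      rw [gaussianReal_preimage_reflect a y v hC]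
      exact gaussianReal_reflect_le v hy hC Set.inter_subset_right
    _ = gaussianReal y v ((reflectionBand a b ∩ Set.Iic (-b)) ∪
        (reflectionBand a b ∩ Set.Ici a)) := by
      rw [measure_union _ hC]
      rw [Set.disjoint_left]
      rintro x ⟨_, h1⟩ ⟨_, h2⟩
      simp only [Set.mem_Iic, Set.mem_Ici] at h1 h2
      linarith
    _ ≤ _ := measure_mono (by rintro x (h | h) <;> exact h.1)

theorem gaussianReal_Ici_le_reflectionBand {a b y : ℝ} (v : ℝ≥0) (ha : 0 < a) (hb : 0 < b)
    (hy : y ≤ -b) :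
    gaussianReal y v (Set.Ici a) ≤ gaussianReal y v (reflectionBand a b) := by
  have h := gaussianReal_Iic_le_reflectionBand (y := -y) v hb ha (by linarith)
  rw [← gaussianReal_map_neg, Measure.map_apply (by fun_prop) measurableSet_Iic,
    Measure.map_apply (by fun_prop) (measurableSet_reflectionBand _ _)] at h
  convert h using 2
  · ext x; simp
  · ext x; exact neg_mem_reflectionBand.symm

theorem gaussianReal_Iic_ge_half {l y : ℝ} (v : ℝ≥0) (hy : y ≤ l) :
    1 ≤ 2 * gaussianReal y v (Set.Iic l) := by
  have h1 : gaussianReal y v (Set.Ici y) = gaussianReal y v (Set.Iic y) := by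
    have := gaussianReal_preimage_reflect y y v (C := Set.Iic y) measurableSet_Iic
    rw [show 2 * y - y = y by ring] at this
    rw [← this]; congr 1; ext x; simp only [Set.mem_preimage, Set.mem_Iic, Set.mem_Ici]
    constructor <;> intro h <;> linarith
  calc (1 : ℝ≥0∞) = gaussianReal y v Set.univ := by simp
    _ ≤ gaussianReal y v (Set.Iic y ∪ Set.Ici y) := measure_mono (by
        intro x _; exact le_total x y)
    _ ≤ _ := measure_union_le _ _
    _ = 2 * gaussianReal y v (Set.Iic y) := by rw [h1, two_mul]
    _ ≤ _ := by gcongr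

/-! ### Gaussian walks and the discrete reflection principle -/

/-- Adapted real sequence whose increments up to time `N` are centered Gaussian and independent
of the past. -/
structure IsGaussianWalk {Ω : Type*} {mΩ : MeasurableSpace Ω} (X : ℕ → Ω → ℝ)
    (F : Filtration ℕ mΩ) (N : ℕ) (P : Measure Ω) : Prop where
  measurable : ∀ k, Measurable[F k] (X k)
  indep : ∀ k ≤ N, Indep (F k) (MeasurableSpace.comap (fun ω => X N ω - X k ω) inferInstance) P
  law : ∀ k ≤ N, ∃ v : ℝ≥0, P.map (fun ω => X N ω - X k ω) = gaussianReal 0 v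

namespace IsGaussianWalk

variable {Ω : Type*} {mΩ : MeasurableSpace Ω} {X : ℕ → Ω → ℝ} {F : Filtration ℕ mΩ} {N : ℕ}
  {P : Measure Ω}

theorem neg (h : IsGaussianWalk X F N P) : IsGaussianWalk (fun k ω => -X k ω) F N P where
  measurable k := (h.measurable k).neg
  indep k hk := by
    refine indep_of_indep_of_le_right (h.indep k hk) ?_
    rintro s ⟨t, ht, rfl⟩
    refine ⟨(fun x => -x) ⁻¹' t, measurable_neg ht, ?_⟩
    ext ω; simp only [Set.mem_preimage]; ring_nf
  law k hk := by
    obtain ⟨v, hv⟩ := h.law k hk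
    refine ⟨v, ?_⟩
    have hm : Measurable (fun ω => X N ω - X k ω) :=
      ((h.measurable N).mono (F.le N) le_rfl).sub ((h.measurable k).mono (F.le k) le_rfl)
    have : (fun ω => -X N ω - -X k ω) = (fun x => -x) ∘ (fun ω => X N ω - X k ω) := by
      ext ω; simp only [Function.comp]; ring
    rw [this, ← Measure.map_map measurable_neg hm, hv, gaussianReal_map_neg, neg_zero]

theorem measurable' (h : IsGaussianWalk X F N P) (k : ℕ) : Measurable (X k) :=
  (h.measurable k).mono (F.le k) le_rfl

/-- Given the past at time `k`, the end point is Gaussian around `X k`. The pair (indicator of `A`,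
`X k`) carries all that is needed of the past, so independence and Fubini apply to real variables.
-/
theorem measure_inter_preimage [IsProbabilityMeasure P] (h : IsGaussianWalk X F N P) {k : ℕ}
    (hk : k ≤ N) :
    ∃ v : ℝ≥0, ∀ A : Set Ω, MeasurableSet[F k] A → ∀ C : Set ℝ, MeasurableSet C →
      P (A ∩ X N ⁻¹' C) = ∫⁻ ω in A, gaussianReal (X k ω) v C ∂P := by
  obtain ⟨v, hv⟩ := h.law k hk
  refine ⟨v, fun A hA C hC => ?_⟩
  have hA' : MeasurableSet A := F.le k _ hA
  have hUF : Measurable[F k] (fun ω => (A.indicator (1 : Ω → ℝ) ω, X k ω)) :=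
    (Measurable.indicator measurable_const hA).prodMk (h.measurable k)
  have hU : Measurable (fun ω => (A.indicator (1 : Ω → ℝ) ω, X k ω)) := hUF.mono (F.le k) le_rfl
  have hZ : Measurable (fun ω => X N ω - X k ω) := (h.measurable' N).sub (h.measurable' k)
  have hind : IndepFun (fun ω => (A.indicator (1 : Ω → ℝ) ω, X k ω))
      (fun ω => X N ω - X k ω) P := by
    rw [IndepFun_iff_Indep]
    exact indep_of_indep_of_le_left (h.indep k hk) hUF.comap_le
  have hD : MeasurableSet {p : (ℝ × ℝ) × ℝ | p.1.1 = 1 ∧ p.1.2 + p.2 ∈ C} := by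
    refine MeasurableSet.inter ?_ ?_
    · exact measurableSet_eq_fun (by fun_prop) (by fun_prop)
    · exact (by fun_prop : Measurable fun p : (ℝ × ℝ) × ℝ => p.1.2 + p.2) hC
  have e1 : A ∩ X N ⁻¹' C = (fun ω => ((A.indicator (1 : Ω → ℝ) ω, X k ω), X N ω - X k ω)) ⁻¹'
      {p : (ℝ × ℝ) × ℝ | p.1.1 = 1 ∧ p.1.2 + p.2 ∈ C} := by
    ext ω
    by_cases hω : ω ∈ A <;> simp [hω]
  rw [e1, ← Measure.map_apply (hU.prodMk hZ) hD,
    (indepFun_iff_map_prod_eq_prod_map_map hU.aemeasurable hZ.aemeasurable).1 hind, hv,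
    Measure.prod_apply hD, lintegral_map (measurable_measure_prodMk_left hD) hU,
    ← lintegral_indicator hA']
  congr 1
  ext ω
  by_cases hω : ω ∈ A
  · have := gaussianReal_map_const_add (μ := 0) (v := v) (X k ω)
    rw [zero_add] at this
    simp only [hω, Set.indicator_of_mem]
    rw [← this, Measure.map_apply (by fun_prop) hC]
    congr 1
    ext z; simp
  · simp [hω]

/-- Lifts a comparison of Gaussian masses around the current position to the walk, on an event of
the past. It is asked for every `v` because `IsGaussianWalk` leaves the variance of the remaining
increment unspecified. -/
theorem measure_inter_le_of_gaussianReal_le [IsProbabilityMeasure P] (h : IsGaussianWalk X F N P)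
    {k : ℕ} (hk : k ≤ N) {A : Set Ω} (hA : MeasurableSet[F k] A) {C D : Set ℝ}
    (hC : MeasurableSet C) (hD : MeasurableSet D) {c d : ℝ≥0∞} (hd : d ≠ ∞) (hc : c ≠ ∞)
    (hle : ∀ ω ∈ A, ∀ v : ℝ≥0,
      c * gaussianReal (X k ω) v C ≤ d * gaussianReal (X k ω) v D) :
    c * P (A ∩ X N ⁻¹' C) ≤ d * P (A ∩ X N ⁻¹' D) := by
  obtain ⟨v, hv⟩ := h.measure_inter_preimage hk
  rw [hv A hA C hC, hv A hA D hD, ← lintegral_const_mul' _ _ hc, ← lintegral_const_mul' _ _ hd]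
  exact setLIntegral_mono' (F.le k _ hA) fun ω hω => hle ω hω v

theorem measurableSet_apply_le (h : IsGaussianWalk X F N P) (k : ℕ) (l : ℝ) :
    MeasurableSet[F k] {ω | X k ω ≤ l} := h.measurable k measurableSet_Iic

theorem measurableSet_le_apply (h : IsGaussianWalk X F N P) (k : ℕ) (l : ℝ) :
    MeasurableSet[F k] {ω | l ≤ X k ω} := h.measurable k measurableSet_Ici

/-- The one-sided reflection inequality, localized to an event of the past. -/
theorem measure_exists_le [IsProbabilityMeasure P] (h : IsGaussianWalk X F N P) (l : ℝ) {k : ℕ}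
    (hk : k ≤ N) : ∀ A : Set Ω, MeasurableSet[F k] A →
      P (A ∩ {ω | ∃ j, k ≤ j ∧ j ≤ N ∧ X j ω ≤ l}) ≤ 2 * P (A ∩ X N ⁻¹' Set.Iic l) := by
  have hhit : ∀ k ≤ N, ∀ A : Set Ω, MeasurableSet[F k] A →
      P (A ∩ {ω | X k ω ≤ l}) ≤ 2 * P ((A ∩ {ω | X k ω ≤ l}) ∩ X N ⁻¹' Set.Iic l) := by
    intro k hk A hA
    have := h.measure_inter_le_of_gaussianReal_le hk (hA.inter (h.measurableSet_apply_le k l))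
      MeasurableSet.univ measurableSet_Iic (c := 1) (d := 2) (D := Set.Iic l) (by simp) (by simp)
      (fun ω hω v => by simpa using gaussianReal_Iic_ge_half v hω.2)
    simpa using this
  -- Backward induction on the starting time stands in for a stopping time: either the level is
  -- reached at time `k`, or `A` shrinks to the event that it is not and time `k + 1` takes over.
  induction hk using Nat.decreasingInduction with
  | self =>
    intro A hA
    refine (measure_mono ?_).trans ((hhit N le_rfl A hA).trans ?_)
    · rintro ω ⟨hω, j, h1, h2, h3⟩
      obtain rfl := le_antisymm h1 h2
      exact ⟨hω, h3⟩
    · gcongr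
      exact Set.inter_subset_left
  | of_succ k hk ih =>
    intro A hA
    have hA2 : MeasurableSet[F k] (A \ {ω | X k ω ≤ l}) := hA.diff (h.measurableSet_apply_le k l)
    have h2 := ih _ (F.mono (Nat.le_succ k) _ hA2)
    have h1 := hhit k hk.le A hA
    calc P (A ∩ {ω | ∃ j, k ≤ j ∧ j ≤ N ∧ X j ω ≤ l})
        ≤ P ((A ∩ {ω | X k ω ≤ l}) ∪ ((A \ {ω | X k ω ≤ l}) ∩
            {ω | ∃ j, k + 1 ≤ j ∧ j ≤ N ∧ X j ω ≤ l})) := by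
          refine measure_mono ?_
          rintro ω ⟨hω, j, h1, h2, h3⟩
          by_cases hl : X k ω ≤ l
          · exact Or.inl ⟨hω, hl⟩
          · refine Or.inr ⟨⟨hω, hl⟩, j, ?_, h2, h3⟩
            rcases h1.lt_or_eq with h | rfl
            · exact h
            · exact absurd h3 hl
      _ ≤ _ := measure_union_le _ _
      _ ≤ _ := add_le_add h1 h2
      _ = 2 * P (A ∩ X N ⁻¹' Set.Iic l) := by
          rw [← mul_add, ← measure_union]
          · congr 2
            ext ω
            simp only [Set.mem_union, Set.mem_inter_iff, Set.mem_sdiff]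
            tauto
          · rw [Set.disjoint_left]
            rintro ω ⟨⟨_, h1⟩, _⟩ ⟨⟨_, h2⟩, _⟩
            exact h2 h1
          · exact (F.le k _ hA2).inter (h.measurable' N measurableSet_Iic)

theorem measure_exists_ge [IsProbabilityMeasure P] (h : IsGaussianWalk X F N P) (l : ℝ) {k : ℕ}
    (hk : k ≤ N) (A : Set Ω) (hA : MeasurableSet[F k] A) :
      P (A ∩ {ω | ∃ j, k ≤ j ∧ j ≤ N ∧ l ≤ X j ω}) ≤ 2 * P (A ∩ X N ⁻¹' Set.Ici l) := by
  have := h.neg.measure_exists_le (-l) hk A hA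
  simp only [neg_le_neg_iff] at this
  refine this.trans_eq ?_
  congr 3
  ext ω; simp

/-- The two-sided reflection inequality. -/
theorem measure_exists_ge_and_exists_le [IsProbabilityMeasure P] (h : IsGaussianWalk X F N P)
    {a b : ℝ} (ha : 0 < a) (hb : 0 < b) {k : ℕ}
    (hk : k ≤ N) : ∀ A : Set Ω, MeasurableSet[F k] A →
      P (A ∩ {ω | (∃ j, k ≤ j ∧ j ≤ N ∧ a ≤ X j ω) ∧ ∃ j, k ≤ j ∧ j ≤ N ∧ X j ω ≤ -b}) ≤
        2 * P (A ∩ X N ⁻¹' reflectionBand a b) := by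
  have hB := measurableSet_reflectionBand a b
  -- From a position above `a`, one-sided reflection reduces a later visit below `-b` to an end
  -- point below `-b`; the Gaussian comparison then trades that half-line for the band.
  have hhit1 : ∀ k ≤ N, ∀ A : Set Ω, MeasurableSet[F k] A →
      P ((A ∩ {ω | a ≤ X k ω}) ∩ {ω | ∃ j, k ≤ j ∧ j ≤ N ∧ X j ω ≤ -b}) ≤
        2 * P ((A ∩ {ω | a ≤ X k ω}) ∩ X N ⁻¹' reflectionBand a b) := by
    intro k hk A hA
    have hA' := hA.inter (h.measurableSet_le_apply k a)
    refine (h.measure_exists_le (-b) hk _ hA').trans ?_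
    refine h.measure_inter_le_of_gaussianReal_le hk hA' measurableSet_Iic hB (by simp) (by simp) ?_
    intro ω hω v
    exact mul_le_mul_right (gaussianReal_Iic_le_reflectionBand v ha hb hω.2) 2
  have hhit2 : ∀ k ≤ N, ∀ A : Set Ω, MeasurableSet[F k] A →
      P ((A ∩ {ω | X k ω ≤ -b}) ∩ {ω | ∃ j, k ≤ j ∧ j ≤ N ∧ a ≤ X j ω}) ≤
        2 * P ((A ∩ {ω | X k ω ≤ -b}) ∩ X N ⁻¹' reflectionBand a b) := by
    intro k hk A hA
    have hA' := hA.inter (h.measurableSet_apply_le k (-b))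
    refine (h.measure_exists_ge a hk _ hA').trans ?_
    refine h.measure_inter_le_of_gaussianReal_le hk hA' measurableSet_Ici hB (by simp) (by simp) ?_
    intro ω hω v
    exact mul_le_mul_right (gaussianReal_Ici_le_reflectionBand v ha hb hω.2) 2
  -- The same backward induction, now split by which of the two levels is reached at time `k`; at `k
  -- = N` a single position would have to satisfy both.
  induction hk using Nat.decreasingInduction with
  | self =>
    intro A hA
    rw [measure_mono_null (t := ∅) _ measure_empty]
    · simp
    · rintro ω ⟨hω, ⟨j, h1, h2, h3⟩, i, h4, h5, h6⟩
      obtain rfl := le_antisymm h1 h2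
      obtain rfl := le_antisymm h4 h5
      exfalso; linarith
  | of_succ k hk ih =>
    intro A hA
    have hA1 : MeasurableSet[F k] (A ∩ {ω | a ≤ X k ω}) := hA.inter (h.measurableSet_le_apply k a)
    have hA2 : MeasurableSet[F k] (A ∩ {ω | X k ω ≤ -b}) := hA.inter (h.measurableSet_apply_le k (-b))
    have hA3 : MeasurableSet[F k] ((A \ {ω | a ≤ X k ω}) \ {ω | X k ω ≤ -b}) :=
      (hA.diff (h.measurableSet_le_apply k a)).diff (h.measurableSet_apply_le k (-b))
    have h3 := ih _ (F.mono (Nat.le_succ k) _ hA3)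
    have h1 := hhit1 k hk.le A hA
    have h2 := hhit2 k hk.le A hA
    have hNB := h.measurable' N hB
    have hM2 := (F.le k _ hA2).inter hNB
    have hM3 := (F.le k _ hA3).inter hNB
    calc _ ≤ P (((A ∩ {ω | a ≤ X k ω}) ∩ {ω | ∃ j, k ≤ j ∧ j ≤ N ∧ X j ω ≤ -b}) ∪
          (((A ∩ {ω | X k ω ≤ -b}) ∩ {ω | ∃ j, k ≤ j ∧ j ≤ N ∧ a ≤ X j ω}) ∪
          (((A \ {ω | a ≤ X k ω}) \ {ω | X k ω ≤ -b}) ∩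
            {ω | (∃ j, k + 1 ≤ j ∧ j ≤ N ∧ a ≤ X j ω) ∧
              ∃ j, k + 1 ≤ j ∧ j ≤ N ∧ X j ω ≤ -b}))) := by
          refine measure_mono ?_
          rintro ω ⟨hω, ⟨j, h1, h2, h3⟩, i, h4, h5, h6⟩
          by_cases hl : a ≤ X k ω
          · exact Or.inl ⟨⟨hω, hl⟩, i, h4, h5, h6⟩
          by_cases hl' : X k ω ≤ -b
          · exact Or.inr (Or.inl ⟨⟨hω, hl'⟩, j, h1, h2, h3⟩)
          refine Or.inr (Or.inr ⟨⟨⟨hω, hl⟩, hl'⟩, ⟨j, ?_, h2, h3⟩, i, ?_, h5, h6⟩)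
          · rcases h1.lt_or_eq with h | rfl
            · exact h
            · exact absurd h3 hl
          · rcases h4.lt_or_eq with h | rfl
            · exact h
            · exact absurd h6 hl'
      _ ≤ _ := (measure_union_le _ _).trans (add_le_add le_rfl (measure_union_le _ _))
      _ ≤ _ := add_le_add h1 (add_le_add h2 h3)
      _ = 2 * P (A ∩ X N ⁻¹' reflectionBand a b) := by
          rw [← mul_add, ← mul_add, ← measure_union _ hM3, ← measure_union _ (hM2.union hM3)]
          · congr 2
            ext ω
            simp only [Set.mem_union, Set.mem_inter_iff, Set.mem_sdiff]
            tauto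
          · rw [Set.disjoint_left]
            rintro ω ⟨⟨_, h1⟩, _⟩ (⟨⟨_, h2⟩, _⟩ | ⟨⟨⟨_, h2⟩, _⟩, _⟩)
            · simp only [Set.mem_ofPred_eq] at h1 h2; linarith
            · exact h2 h1
          · rw [Set.disjoint_left]
            rintro ω ⟨⟨_, h1⟩, _⟩ ⟨⟨_, h2⟩, _⟩
            exact h2 h1

end IsGaussianWalk

/-! ### The area of the parameters whose band contains a point, and the series for `log 2` -/

theorem measurableSet_triangle (p q x : ℝ) :
    MeasurableSet {u : ℝ × ℝ | 0 < u.1 ∧ 0 < u.2 ∧ p * u.1 + q * u.2 < x} :=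
  (measurableSet_lt (f := fun _ => 0) (g := fun u : ℝ × ℝ => u.1) (by fun_prop)
    (by fun_prop)).inter <| (measurableSet_lt (f := fun _ => 0) (g := fun u : ℝ × ℝ => u.2)
    (by fun_prop) (by fun_prop)).inter <|
    measurableSet_lt (f := fun u : ℝ × ℝ => p * u.1 + q * u.2) (g := fun _ => x) (by fun_prop)
      (by fun_prop)

theorem volume_triangle {p q x : ℝ} (hp : 0 < p) (hq : 0 < q) (hx : 0 ≤ x) :
    volume {u : ℝ × ℝ | 0 < u.1 ∧ 0 < u.2 ∧ p * u.1 + q * u.2 < x} =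
      ENNReal.ofReal (x ^ 2 / (2 * p * q)) := by
  have hm : MeasurableSet {u : ℝ × ℝ | 0 < u.1 ∧ 0 < u.2 ∧ p * u.1 + q * u.2 < x} :=
    measurableSet_triangle p q x
  rw [Measure.volume_eq_prod, Measure.prod_apply hm]
  have hs : ∀ s : ℝ, volume (Prod.mk s ⁻¹' {u : ℝ × ℝ | 0 < u.1 ∧ 0 < u.2 ∧
      p * u.1 + q * u.2 < x}) =
      (Set.Ioc 0 (x / p)).indicator (fun s => ENNReal.ofReal ((x - p * s) / q)) s := by
    intro s
    by_cases h : s ∈ Set.Ioc 0 (x / p)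
    · rw [Set.indicator_of_mem h]
      have : Prod.mk s ⁻¹' {u : ℝ × ℝ | 0 < u.1 ∧ 0 < u.2 ∧ p * u.1 + q * u.2 < x} =
          Set.Ioo 0 ((x - p * s) / q) := by
        ext t
        simp only [Set.mem_preimage, Set.mem_ofPred_eq, h.1, true_and, Set.mem_Ioo,
          lt_div_iff₀ hq]
        constructor <;> rintro ⟨h1, h2⟩ <;> exact ⟨h1, by linarith⟩
      rw [this, Real.volume_Ioo, sub_zero]
    · rw [Set.indicator_of_notMem h]
      refine measure_mono_null (t := ∅) ?_ measure_empty
      rintro t ⟨h1, h2, h3⟩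
      refine h ⟨h1, ?_⟩
      rw [le_div_iff₀ hp]
      have := mul_pos hq h2
      simp only at *
      linarith
  simp_rw [hs]
  rw [lintegral_indicator measurableSet_Ioc]
  have h0 : 0 ≤ x / p := by positivity
  have hc : Continuous fun s : ℝ => (x - p * s) / q := by fun_prop
  rw [← ofReal_integral_eq_lintegral_ofReal (hc.integrableOn_Ioc)]
  · rw [← intervalIntegral.integral_of_le h0]
    congr 1
    have h1 : ∫ s in (0 : ℝ)..(x / p), p * s = p * (((x / p) ^ 2 - 0 ^ 2) / 2) := by
      rw [intervalIntegral.integral_const_mul, integral_id]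
    have h2 : ∫ s in (0 : ℝ)..(x / p), (x - p * s) =
        (∫ s in (0 : ℝ)..(x / p), x) - ∫ s in (0 : ℝ)..(x / p), p * s :=
      intervalIntegral.integral_sub (by simp) (Continuous.intervalIntegrable (by fun_prop) _ _)
    rw [intervalIntegral.integral_div, h2, h1, intervalIntegral.integral_const, smul_eq_mul]
    field_simp
    ring
  · refine (ae_restrict_iff' measurableSet_Ioc).2 (ae_of_all _ fun s hs => ?_)
    have := (le_div_iff₀ hp).1 hs.2
    have : 0 ≤ x - p * s := by linarith
    simp only [Pi.zero_apply]
    positivity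

/-- The region lies between two nested triangles, with coefficients `(k, k - 1)` and `(k + 1, k)`.
It is used with `k = 2 * i`, `i` being the index of an interval of the band. -/
theorem volume_triangle_diff_le {k x : ℝ} (hk : 1 < k) (hx : 0 ≤ x) :
    volume {u : ℝ × ℝ | 0 < u.1 ∧ 0 < u.2 ∧ k * u.1 + (k - 1) * u.2 ≤ x ∧
      x ≤ (k + 1) * u.1 + k * u.2} ≤
      ENNReal.ofReal (x ^ 2 * ((1 / (k * (k - 1)) - 1 / ((k + 1) * k)) / 2)) := by
  set T₁ := {u : ℝ × ℝ | 0 < u.1 ∧ 0 < u.2 ∧ (k + 1) * u.1 + k * u.2 < x} with hT₁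
  have hm : MeasurableSet T₁ := measurableSet_triangle _ _ _
  have hT := volume_triangle (p := k + 1) (q := k) (x := x) (by linarith) (by linarith) hx
  have hk0 : 0 < k := by linarith
  have hk1 : 0 < k - 1 := by linarith
  -- The closed triangle is contained in slightly larger open ones.
  refine le_of_forall_gt_imp_ge_of_dense ?_
  intro c hc
  have hcont : Filter.Tendsto (fun y : ℝ => ENNReal.ofReal
      (y ^ 2 / (2 * k * (k - 1)) - x ^ 2 / (2 * (k + 1) * k)))
      (nhdsWithin x (Set.Ioi x)) (nhds (ENNReal.ofReal
        (x ^ 2 * ((1 / (k * (k - 1)) - 1 / ((k + 1) * k)) / 2)))) := by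
    have : x ^ 2 * ((1 / (k * (k - 1)) - 1 / ((k + 1) * k)) / 2) =
        x ^ 2 / (2 * k * (k - 1)) - x ^ 2 / (2 * (k + 1) * k) := by field_simp
    rw [this]
    refine (ENNReal.continuous_ofReal.tendsto _).comp ?_
    have hcc : Continuous (fun y : ℝ => y ^ 2 / (2 * k * (k - 1)) - x ^ 2 / (2 * (k + 1) * k)) := by
      fun_prop
    exact (hcc.tendsto x).mono_left nhdsWithin_le_nhds
  obtain ⟨y, hy, hxy⟩ := ((hcont.eventually (gt_mem_nhds hc)).and self_mem_nhdsWithin).exists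
  refine le_trans ?_ hy.le
  have hxy' : x < y := hxy
  have hT2 := volume_triangle (p := k) (q := k - 1) (x := y) hk0 hk1 (by linarith)
  calc _ ≤ volume ({u : ℝ × ℝ | 0 < u.1 ∧ 0 < u.2 ∧ k * u.1 + (k - 1) * u.2 < y} \ T₁) := by
        refine measure_mono ?_
        rintro u ⟨h1, h2, h3, h4⟩
        exact ⟨⟨h1, h2, by linarith⟩, fun h => by linarith [h.2.2]⟩
    _ = _ := by
        rw [measure_sdiff _ hm.nullMeasurableSet (by rw [hT]; simp), hT, hT2,
          ENNReal.ofReal_sub _ (by positivity)]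
        rintro u ⟨h1, h2, h3⟩
        exact ⟨h1, h2, by linarith⟩

/-- The terms equal `1 / ((2i+1)(2i+2)(2i+3))`, and their partial sums are `H_{2n} - H_n - 1/2` up
to a vanishing term; Euler's constant cancels in `H_{2n} - H_n → log 2`. -/
theorem hasSum_log_two_aux :
    HasSum (fun i : ℕ => (1 / ((2 * (i + 1) : ℝ) * (2 * (i + 1) - 1)) -
      1 / ((2 * (i + 1) + 1) * (2 * (i + 1)))) / 2) ((2 * Real.log 2 - 1) / 2) := by
  have hterm : ∀ i : ℕ, (1 / ((2 * (i + 1) : ℝ) * (2 * (i + 1) - 1)) -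
      1 / ((2 * (i + 1) + 1) * (2 * (i + 1)))) / 2 =
      1 / ((2 * i + 1) * (2 * i + 2) * (2 * i + 3)) := by
    intro i
    have h1 : (2 * ((i : ℝ) + 1) - 1) = 2 * i + 1 := by ring
    rw [h1]
    field_simp
    ring
  rw [hasSum_iff_tendsto_nat_of_nonneg]
  · have hsum : ∀ n : ℕ, ∑ i ∈ Finset.range n, (1 / ((2 * (i + 1) : ℝ) * (2 * (i + 1) - 1)) -
        1 / ((2 * (i + 1) + 1) * (2 * (i + 1)))) / 2 =
        ((harmonic (2 * n) : ℝ) - harmonic n) - 1 / 2 + 1 / (2 * (2 * n + 1)) := by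
      intro n
      induction n with
      | zero => simp
      | succ n ih =>
        rw [Finset.sum_range_succ, ih, hterm, show 2 * (n + 1) = 2 * n + 1 + 1 by ring,
          harmonic_succ, harmonic_succ, harmonic_succ]
        push_cast
        have h1 : (0 : ℝ) < 2 * n + 1 := by positivity
        field_simp
        ring
    simp_rw [hsum]
    have h1 := Real.tendsto_harmonic_sub_log
    have h2 : Filter.Tendsto (fun n : ℕ => 2 * n) Filter.atTop Filter.atTop :=
      Filter.tendsto_id.const_mul_atTop' (by norm_num)
    have h3 := (h1.comp h2).sub h1
    have h4 : Filter.Tendsto (fun n : ℕ => 1 / (2 * (2 * (n : ℝ) + 1))) Filter.atTop (nhds 0) := by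
      refine Filter.Tendsto.div_atTop tendsto_const_nhds ?_
      refine Filter.Tendsto.const_mul_atTop (by norm_num) ?_
      refine Filter.tendsto_atTop_add_const_right _ _ ?_
      exact tendsto_natCast_atTop_atTop.const_mul_atTop (by norm_num)
    have h5 := ((h3.add_const (Real.log 2)).sub_const (1 / 2)).add h4
    have e : Real.eulerMascheroniConstant - Real.eulerMascheroniConstant + Real.log 2 - 1 / 2 + 0 =
        (2 * Real.log 2 - 1) / 2 := by ring
    rw [e] at h5
    refine h5.congr' ?_
    filter_upwards [Filter.eventually_gt_atTop 0] with n hn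
    have hn' : (n : ℝ) ≠ 0 := by positivity
    simp only [Function.comp]
    push_cast
    rw [Real.log_mul (by norm_num) hn']
    ring
  · intro i
    rw [hterm]
    positivity

/-- For `x > 0` only indices `i ≥ 1` can occur. Read as a condition on `(a, b)`, the interval of
index `i` is the region between the triangles with `k = 2 * i`, and the areas are summed. -/
theorem volume_reflectionBand_pos_le {x : ℝ} (hx : 0 < x) :
    volume {u : ℝ × ℝ | 0 < u.1 ∧ 0 < u.2 ∧ x ∈ reflectionBand u.1 u.2} ≤
      ENNReal.ofReal (x ^ 2 * ((2 * Real.log 2 - 1) / 2)) := by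
  have hsub : {u : ℝ × ℝ | 0 < u.1 ∧ 0 < u.2 ∧ x ∈ reflectionBand u.1 u.2} ⊆
      ⋃ i : ℕ, {u : ℝ × ℝ | 0 < u.1 ∧ 0 < u.2 ∧
        (2 * (i + 1) : ℝ) * u.1 + (2 * (i + 1) - 1) * u.2 ≤ x ∧
        x ≤ (2 * (i + 1) + 1) * u.1 + (2 * (i + 1)) * u.2} := by
    rintro u ⟨h1, h2, i, hi, h3, h4⟩
    rw [Set.mem_iUnion]
    have hi1 : 1 ≤ i := by
      by_contra h
      have : (i : ℝ) ≤ -1 := by exact_mod_cast (by omega : i ≤ -1)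
      nlinarith
    obtain ⟨m, rfl⟩ : ∃ m : ℕ, i = m + 1 := ⟨(i - 1).toNat, by omega⟩
    push_cast at h3 h4
    exact ⟨m, h1, h2, by linarith, by linarith⟩
  refine (measure_mono hsub).trans ((measure_iUnion_le _).trans ?_)
  have hs := hasSum_log_two_aux.mul_left (x ^ 2)
  rw [← hs.tsum_eq, ENNReal.ofReal_tsum_of_nonneg _ hs.summable]
  · refine ENNReal.tsum_le_tsum fun i => ?_
    exact volume_triangle_diff_le (by linarith [(Nat.cast_nonneg i : (0 : ℝ) ≤ i)]) hx.le
  · intro i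
    have hi : (0 : ℝ) ≤ i := Nat.cast_nonneg i
    refine mul_nonneg (sq_nonneg _) (div_nonneg (sub_nonneg.2 ?_) (by norm_num))
    have h1 : (0 : ℝ) < 2 * (i + 1) - 1 := by linarith
    apply one_div_le_one_div_of_le
    · positivity
    · nlinarith

theorem volume_reflectionBand_le (x : ℝ) :
    volume {u : ℝ × ℝ | 0 < u.1 ∧ 0 < u.2 ∧ x ∈ reflectionBand u.1 u.2} ≤
      ENNReal.ofReal (x ^ 2 * ((2 * Real.log 2 - 1) / 2)) := by
  rcases lt_trichotomy x 0 with h | rfl | h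
  · have := volume_reflectionBand_pos_le (neg_pos.2 h)
    rw [neg_sq] at this
    refine le_trans (le_of_eq ?_) this
    have hp : MeasurePreserving (MeasurableEquiv.prodComm : ℝ × ℝ ≃ᵐ ℝ × ℝ) volume volume :=
      Measure.measurePreserving_swap
    rw [← hp.measure_preimage_equiv]
    congr 1
    ext u
    change (0 < u.2 ∧ 0 < u.1 ∧ x ∈ reflectionBand u.2 u.1) ↔
      (0 < u.1 ∧ 0 < u.2 ∧ -x ∈ reflectionBand u.1 u.2)
    rw [neg_mem_reflectionBand]
    tauto
  · refine (measure_mono_null (t := ∅) ?_ measure_empty).trans_le zero_le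
    rintro u ⟨h1, h2, i, hi, h3, h4⟩
    rcases lt_or_gt_of_ne hi with h | h
    · have : (i : ℝ) ≤ -1 := by exact_mod_cast (by omega : i ≤ -1)
      nlinarith
    · have : (1 : ℝ) ≤ i := by exact_mod_cast (by omega : 1 ≤ i)
      nlinarith
  · exact volume_reflectionBand_pos_le h

/-! ### Layer-cake formula for a product -/

section LayerCake

variable {Ω : Type*} {mΩ : MeasurableSpace Ω} {P : Measure Ω}

/-- The product is the area of the rectangle `(0, X] × (0, Y]`; Tonelli exchanges area and
probability. -/
theorem lintegral_mul_eq_lintegral_meas_le [SFinite P] {X Y : Ω → ℝ≥0} (hX : Measurable X)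
    (hY : Measurable Y) :
    ∫⁻ ω, (X ω : ℝ≥0∞) * Y ω ∂P =
      ∫⁻ u : ℝ × ℝ in {u | 0 < u.1 ∧ 0 < u.2}, P {ω | u.1 ≤ X ω ∧ u.2 ≤ Y ω} := by
  have hm0 : MeasurableSet {u : ℝ × ℝ | 0 < u.1 ∧ 0 < u.2} :=
    (measurableSet_lt (f := fun _ => 0) (g := fun u : ℝ × ℝ => u.1) (by fun_prop)
      (by fun_prop)).inter <| measurableSet_lt (f := fun _ => 0) (g := fun u : ℝ × ℝ => u.2)
      (by fun_prop) (by fun_prop)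
  set S : Set ((ℝ × ℝ) × Ω) := {p | (0 < p.1.1 ∧ 0 < p.1.2) ∧ p.1.1 ≤ X p.2 ∧ p.1.2 ≤ Y p.2}
  have hS : MeasurableSet S := by
    refine (hm0.preimage measurable_fst).inter (MeasurableSet.inter ?_ ?_)
    · exact measurableSet_le (f := fun p : (ℝ × ℝ) × Ω => p.1.1) (g := fun p => (X p.2 : ℝ))
        (by fun_prop) (by fun_prop)
    · exact measurableSet_le (f := fun p : (ℝ × ℝ) × Ω => p.1.2) (g := fun p => (Y p.2 : ℝ))
        (by fun_prop) (by fun_prop)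
  calc ∫⁻ ω, (X ω : ℝ≥0∞) * Y ω ∂P
      = ∫⁻ ω, (volume : Measure (ℝ × ℝ)) ((fun u => (u, ω)) ⁻¹' S) ∂P := by
        congr 1
        ext ω
        have : (fun u => (u, ω)) ⁻¹' S = Set.Ioc (0 : ℝ) (X ω) ×ˢ Set.Ioc (0 : ℝ) (Y ω) := by
          ext u
          simp only [S, Set.mem_preimage, Set.mem_ofPred_eq, Set.mem_prod, Set.mem_Ioc]
          tauto
        rw [this, Measure.volume_eq_prod, Measure.prod_prod, Real.volume_Ioc, Real.volume_Ioc]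
        simp
    _ = ((volume : Measure (ℝ × ℝ)).prod P) S := (Measure.prod_apply_symm hS).symm
    _ = ∫⁻ u : ℝ × ℝ, P (Prod.mk u ⁻¹' S) := Measure.prod_apply hS
    _ = _ := by
        rw [← lintegral_indicator hm0]
        congr 1
        ext u
        by_cases hu : 0 < u.1 ∧ 0 < u.2
        · rw [Set.indicator_of_mem (by exact hu)]
          congr 1
          ext ω
          simp [S, hu]
        · rw [Set.indicator_of_notMem (by exact hu)]
          refine measure_mono_null (t := ∅) ?_ measure_empty
          rintro ω ⟨h, _⟩
          exact hu h

/-- Turns a reflection inequality into a moment bound: a second use of Tonelli replaces the joint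
tail by the area of the set of levels `u` that are compatible with the end point `Z`. -/
theorem lintegral_mul_le_of_meas_le [SFinite P] {X Y : Ω → ℝ≥0} (hX : Measurable X)
    (hY : Measurable Y) {Z : Ω → ℝ} (hZ : Measurable Z) {S : Set ((ℝ × ℝ) × ℝ)}
    (hS : MeasurableSet S) {g : ℝ → ℝ≥0∞} {c : ℝ≥0∞} (hc : c ≠ ∞)
    (hP : ∀ u : ℝ × ℝ, 0 < u.1 → 0 < u.2 →
      P {ω | u.1 ≤ X ω ∧ u.2 ≤ Y ω} ≤ c * P {ω | (u, Z ω) ∈ S})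
    (hg : ∀ z, volume {u : ℝ × ℝ | 0 < u.1 ∧ 0 < u.2 ∧ (u, z) ∈ S} ≤ g z) :
    ∫⁻ ω, (X ω : ℝ≥0∞) * Y ω ∂P ≤ c * ∫⁻ ω, g (Z ω) ∂P := by
  have hm0 : MeasurableSet {u : ℝ × ℝ | 0 < u.1 ∧ 0 < u.2} :=
    (measurableSet_lt (f := fun _ => 0) (g := fun u : ℝ × ℝ => u.1) (by fun_prop)
      (by fun_prop)).inter <| measurableSet_lt (f := fun _ => 0) (g := fun u : ℝ × ℝ => u.2)
      (by fun_prop) (by fun_prop)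
  set D : Set ((ℝ × ℝ) × Ω) := {p | (p.1, Z p.2) ∈ S}
  have hD : MeasurableSet D :=
    hS.preimage (by fun_prop : Measurable fun p : (ℝ × ℝ) × Ω => (p.1, Z p.2))
  rw [lintegral_mul_eq_lintegral_meas_le hX hY]
  calc _ ≤ ∫⁻ u : ℝ × ℝ in {u | 0 < u.1 ∧ 0 < u.2}, c * P (Prod.mk u ⁻¹' D) :=
        setLIntegral_mono' hm0 fun u hu => hP u hu.1 hu.2
    _ = c * ((volume.restrict {u : ℝ × ℝ | 0 < u.1 ∧ 0 < u.2}).prod P) D := by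
        rw [lintegral_const_mul' _ _ hc, Measure.prod_apply hD]
    _ = c * ∫⁻ ω, (volume.restrict {u : ℝ × ℝ | 0 < u.1 ∧ 0 < u.2})
          ((fun u => (u, ω)) ⁻¹' D) ∂P := by rw [Measure.prod_apply_symm hD]
    _ ≤ _ := by
        refine mul_le_mul_right (lintegral_mono fun ω => ?_) c
        rw [Measure.restrict_apply (hD.preimage (by fun_prop))]
        refine le_trans (measure_mono ?_) (hg (Z ω))
        rintro u ⟨h1, h2, h3⟩
        exact ⟨h2, h3, h1⟩

end LayerCake

/-! ### Second moment of the range of a Gaussian walk -/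

/-- The maximum over `0, …, N` of the positive parts of a sequence. -/
noncomputable def runningMax (N : ℕ) (x : ℕ → ℝ) : ℝ≥0 :=
  (Finset.range (N + 1)).sup fun j => (x j).toNNReal

theorem le_runningMax_iff {N : ℕ} {x : ℕ → ℝ} {a : ℝ} (ha : 0 < a) :
    a ≤ runningMax N x ↔ ∃ j, j ≤ N ∧ a ≤ x j := by
  lift a to ℝ≥0 using ha.le
  have ha' : (⊥ : ℝ≥0) < a := by simpa using ha
  rw [NNReal.coe_le_coe, runningMax, Finset.le_sup_iff ha']
  constructor
  · rintro ⟨j, hj, h⟩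
    exact ⟨j, by simpa [Nat.lt_succ_iff] using hj, (Real.le_toNNReal_iff_coe_le' ha).1 h⟩
  · rintro ⟨j, hj, h⟩
    exact ⟨j, by simpa [Nat.lt_succ_iff] using hj, (Real.le_toNNReal_iff_coe_le' ha).2 h⟩

theorem measurable_runningMax {Ω : Type*} {mΩ : MeasurableSpace Ω} {X : ℕ → Ω → ℝ}
    (hX : ∀ k, Measurable (X k)) (N : ℕ) : Measurable fun ω => runningMax N fun j => X j ω := by
  unfold runningMax
  induction Finset.range (N + 1) using Finset.cons_induction with
  | empty => simp
  | cons j s hj ih =>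
    simp only [Finset.sup_cons]
    exact (hX j).real_toNNReal.sup ih

theorem measurableSet_reflectionBand_prod :
    MeasurableSet {p : (ℝ × ℝ) × ℝ | p.2 ∈ reflectionBand p.1.1 p.1.2} := by
  have : {p : (ℝ × ℝ) × ℝ | p.2 ∈ reflectionBand p.1.1 p.1.2} = ⋃ i : {i : ℤ // i ≠ 0},
      ({p : (ℝ × ℝ) × ℝ | 2 * ((i : ℤ) : ℝ) * (p.1.1 + p.1.2) - p.1.2 ≤ p.2} ∩
        {p | p.2 ≤ 2 * ((i : ℤ) : ℝ) * (p.1.1 + p.1.2) + p.1.1}) := by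
    ext x
    simp only [reflectionBand, Set.mem_ofPred_eq, Set.mem_iUnion, Set.mem_inter_iff,
      Subtype.exists, exists_prop]
  rw [this]
  exact MeasurableSet.iUnion fun i => (measurableSet_le (by fun_prop) (by fun_prop)).inter
    (measurableSet_le (by fun_prop) (by fun_prop))

namespace IsGaussianWalk

variable {Ω : Type*} {mΩ : MeasurableSpace Ω} {X : ℕ → Ω → ℝ} {F : Filtration ℕ mΩ} {N : ℕ}
  {P : Measure Ω}

/-- The square is treated as a product, with one-sided reflection at level `max u.1 u.2`; the levels
below an end point `z > 0` fill the square `(0, z] × (0, z]`. -/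
theorem lintegral_runningMax_sq_le [IsProbabilityMeasure P] (h : IsGaussianWalk X F N P) :
    ∫⁻ ω, (runningMax N fun j => X j ω : ℝ≥0∞) * (runningMax N fun j => X j ω) ∂P ≤
      2 * ∫⁻ ω, ENNReal.ofReal (max (X N ω) 0 ^ 2) ∂P := by
  have hM := measurable_runningMax h.measurable' N
  refine lintegral_mul_le_of_meas_le hM hM (h.measurable' N) (g := fun z =>
    ENNReal.ofReal (max z 0 ^ 2)) (S := {p | p.1.1 ≤ p.2 ∧ p.1.2 ≤ p.2}) ?_ (by simp) ?_ ?_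
  · exact (measurableSet_le (f := fun p : (ℝ × ℝ) × ℝ => p.1.1) (g := fun p => p.2)
      (by fun_prop) (by fun_prop)).inter (measurableSet_le (f := fun p : (ℝ × ℝ) × ℝ => p.1.2)
      (g := fun p => p.2) (by fun_prop) (by fun_prop))
  · intro u h1 h2
    have := h.measure_exists_ge (max u.1 u.2) (k := 0) (Nat.zero_le _) Set.univ MeasurableSet.univ
    simp only [Set.univ_inter] at this
    refine le_trans (measure_mono ?_) (this.trans_eq ?_)
    · rintro ω ⟨h3, h4⟩
      have h5 : max u.1 u.2 ≤ (runningMax N fun j => X j ω : ℝ) := max_le h3 h4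
      rw [le_runningMax_iff (lt_max_of_lt_left h1)] at h5
      obtain ⟨j, hj, h6⟩ := h5
      exact ⟨j, Nat.zero_le _, hj, h6⟩
    · congr 2
      ext ω
      simp
  · intro z
    calc _ ≤ volume (Set.Ioc (0 : ℝ) z ×ˢ Set.Ioc (0 : ℝ) z) := by
          refine measure_mono ?_
          rintro u ⟨h1, h2, h3, h4⟩
          exact ⟨⟨h1, h3⟩, h2, h4⟩
      _ ≤ _ := by
          rw [Measure.volume_eq_prod, Measure.prod_prod, Real.volume_Ioc, sub_zero, sq,
            ENNReal.ofReal_mul (le_max_right _ _)]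
          gcongr <;> exact le_max_left _ _

theorem lintegral_runningMax_mul_runningMax_neg_le [IsProbabilityMeasure P]
    (h : IsGaussianWalk X F N P) :
    ∫⁻ ω, (runningMax N fun j => X j ω : ℝ≥0∞) * (runningMax N fun j => -X j ω) ∂P ≤
      2 * ∫⁻ ω, ENNReal.ofReal (X N ω ^ 2 * ((2 * Real.log 2 - 1) / 2)) ∂P := by
  have hM := measurable_runningMax h.measurable' N
  have hM' := measurable_runningMax h.neg.measurable' N
  refine lintegral_mul_le_of_meas_le hM hM' (h.measurable' N) (g := fun z =>
    ENNReal.ofReal (z ^ 2 * ((2 * Real.log 2 - 1) / 2))) measurableSet_reflectionBand_prod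
    (by simp) ?_ volume_reflectionBand_le
  intro u h1 h2
  have := h.measure_exists_ge_and_exists_le h1 h2 (k := 0) (Nat.zero_le _) Set.univ
    MeasurableSet.univ
  simp only [Set.univ_inter] at this
  refine le_trans (measure_mono ?_) this
  rintro ω ⟨h3, h4⟩
  rw [le_runningMax_iff h1] at h3
  rw [le_runningMax_iff h2] at h4
  obtain ⟨j, hj, h6⟩ := h3
  obtain ⟨i, hi, h7⟩ := h4
  exact ⟨⟨j, Nat.zero_le _, hj, h6⟩, i, Nat.zero_le _, hi, by linarith⟩

/-- The mean square of the range of a Gaussian walk. -/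
theorem lintegral_range_sq_le [IsProbabilityMeasure P] (h : IsGaussianWalk X F N P) :
    ∫⁻ ω, ((runningMax N fun j => X j ω : ℝ≥0∞) + (runningMax N fun j => -X j ω)) ^ 2 ∂P ≤
      ENNReal.ofReal (4 * Real.log 2) * ∫⁻ ω, ENNReal.ofReal (X N ω ^ 2) ∂P := by
  have hM := measurable_runningMax h.measurable' N
  have hM' := measurable_runningMax h.neg.measurable' N
  have hXN := h.measurable' N
  -- This keeps `(2 * log 2 - 1) / 2` nonnegative, so that `ENNReal.ofReal` is additive in the final
  -- identity `2 + 4 * ((2 * log 2 - 1) / 2) = 4 * log 2`.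
  have hlog : 1 / 2 < Real.log 2 := by linarith [Real.log_two_gt_d9]
  have h1 := h.lintegral_runningMax_sq_le
  have h2 := h.neg.lintegral_runningMax_sq_le
  have h3 := h.lintegral_runningMax_mul_runningMax_neg_le
  have e1 : ∫⁻ ω, ENNReal.ofReal (max (X N ω) 0 ^ 2) ∂P +
      ∫⁻ ω, ENNReal.ofReal (max (-X N ω) 0 ^ 2) ∂P = ∫⁻ ω, ENNReal.ofReal (X N ω ^ 2) ∂P := by
    rw [← lintegral_add_left (by fun_prop)]
    congr 1
    ext ω
    rw [← ENNReal.ofReal_add (sq_nonneg _) (sq_nonneg _)]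
    congr 1
    rcases le_total (X N ω) 0 with h | h
    · rw [max_eq_right h, max_eq_left (by linarith)]; ring
    · rw [max_eq_left h, max_eq_right (by linarith)]; ring
  have e2 : ∫⁻ ω, ENNReal.ofReal (X N ω ^ 2 * ((2 * Real.log 2 - 1) / 2)) ∂P =
      (∫⁻ ω, ENNReal.ofReal (X N ω ^ 2) ∂P) * ENNReal.ofReal ((2 * Real.log 2 - 1) / 2) := by
    rw [← lintegral_mul_const _ (by fun_prop)]
    congr 1
    ext ω
    rw [ENNReal.ofReal_mul (sq_nonneg _)]
  rw [e2] at h3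
  set E := ∫⁻ ω, ENNReal.ofReal (X N ω ^ 2) ∂P
  have e3 : ∀ ω, ((runningMax N fun j => X j ω : ℝ≥0∞) + (runningMax N fun j => -X j ω)) ^ 2 =
      ((runningMax N fun j => X j ω : ℝ≥0∞) * (runningMax N fun j => X j ω) +
      (runningMax N fun j => -X j ω : ℝ≥0∞) * (runningMax N fun j => -X j ω)) +
      2 * ((runningMax N fun j => X j ω : ℝ≥0∞) * (runningMax N fun j => -X j ω)) := by
    intro ω; ring
  simp_rw [e3]
  rw [lintegral_add_left (by fun_prop), lintegral_add_left (by fun_prop),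
    lintegral_const_mul _ (by fun_prop)]
  calc _ ≤ (2 * ∫⁻ ω, ENNReal.ofReal (max (X N ω) 0 ^ 2) ∂P +
        2 * ∫⁻ ω, ENNReal.ofReal (max (-X N ω) 0 ^ 2) ∂P) +
        2 * (2 * (E * ENNReal.ofReal ((2 * Real.log 2 - 1) / 2))) := by gcongr
    _ = (2 + 4 * ENNReal.ofReal ((2 * Real.log 2 - 1) / 2)) * E := by
        rw [← mul_add, e1]; ring
    _ = _ := by
        congr 1
        rw [show (2 : ℝ≥0∞) = ENNReal.ofReal 2 by simp, show (4 : ℝ≥0∞) = ENNReal.ofReal 4 by simp,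
          ← ENNReal.ofReal_mul (by norm_num), ← ENNReal.ofReal_add (by norm_num) (by linarith)]
        congr 1
        ring

end IsGaussianWalk

/-! ### From grids to continuous time for linear Brownian motion -/

section Law

variable {Ω : Type*} {mΩ : MeasurableSpace Ω} {B : ℝ≥0 → Ω → ℝ} {P : Measure Ω}

theorem lintegral_sq_gaussianReal (v : ℝ≥0) :
    ∫⁻ x, ENNReal.ofReal (x ^ 2) ∂gaussianReal 0 v = v := by
  have h2 : MemLp (id : ℝ → ℝ) 2 (gaussianReal 0 v) := memLp_id_gaussianReal 2
  have h3 : Integrable (fun x : ℝ => x ^ 2) (gaussianReal 0 v) := h2.integrable_sq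
  rw [← ofReal_integral_eq_lintegral_ofReal h3 (ae_of_all _ fun x => sq_nonneg x)]
  have := variance_id_gaussianReal (μ := 0) (v := v)
  rw [variance_of_integral_eq_zero (by fun_prop) (by simp)] at this
  simp only [id] at this ⊢
  rw [this]
  simp

theorem ProbabilityTheory.IsPreBrownianReal.lintegral_sq (hB : IsPreBrownianReal B P) (t : ℝ≥0) :
    ∫⁻ ω, ENNReal.ofReal (B t ω ^ 2) ∂P = t := by
  have h := hB.hasLaw_eval t
  rw [← lintegral_sq_gaussianReal t, ← h.map_eq, lintegral_map' (by fun_prop) h.aemeasurable]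

/-- The values of `B` are only almost everywhere measurable, so the walk consists of measurable
versions with their natural filtration; countably many times allow one common null set. -/
theorem ProbabilityTheory.IsPreBrownianReal.exists_isGaussianWalk (hB : IsPreBrownianReal B P)
    (h : ℝ≥0) (N : ℕ) :
    ∃ (X : ℕ → Ω → ℝ) (F : Filtration ℕ mΩ), IsGaussianWalk X F N P ∧
      ∀ k : ℕ, B (k * h) =ᵐ[P] X k := by
  have hm : ∀ k : ℕ, AEMeasurable (B (k * h)) P := fun k => hB.aemeasurable _
  obtain ⟨X, hXm, hBX⟩ : ∃ X : ℕ → Ω → ℝ, (∀ k, Measurable (X k)) ∧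
      ∀ k : ℕ, B (k * h) =ᵐ[P] X k :=
    ⟨fun k => (hm k).mk _, fun k => (hm k).measurable_mk, fun k => (hm k).ae_eq_mk⟩
  have hX : ∀ k, StronglyMeasurable (X k) := fun k => (hXm k).stronglyMeasurable
  refine ⟨X, Filtration.natural X hX, ⟨?_, ?_, ?_⟩, hBX⟩
  · intro k
    exact (Filtration.stronglyAdapted_natural hX k).measurable
  · intro k hk
    have h1 := hB.indepFun_shift (k * h)
    have h2 : IndepFun (fun ω (j : Set.Iic k) => B ((j : ℕ) * h) ω)
        (fun ω => B (N * h) ω - B (k * h) ω) P := by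
      have hφ : Measurable fun (x : Set.Iic ((k : ℝ≥0) * h) → ℝ) (j : Set.Iic k) =>
          x ⟨(j : ℕ) * h, mul_le_mul_left (Nat.cast_le.2 j.2) h⟩ :=
        measurable_pi_lambda _ fun _ => measurable_pi_apply _
      have hψ : Measurable fun x : ℝ≥0 → ℝ => x ((N - k : ℕ) * h) := measurable_pi_apply _
      have := h1.symm.comp hφ hψ
      have he : (N : ℝ≥0) * h = k * h + (N - k : ℕ) * h := by
        rw [← add_mul, ← Nat.cast_add, Nat.add_sub_cancel' hk]
      rw [he]
      exact this
    have h3 : IndepFun (fun ω (j : Set.Iic k) => X j ω) (fun ω => X N ω - X k ω) P := by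
      refine h2.congr ?_ ?_
      · have : ∀ᵐ ω ∂P, ∀ j : ℕ, B (j * h) ω = X j ω := ae_all_iff.2 hBX
        filter_upwards [this] with ω hω
        ext j
        exact hω j
      · filter_upwards [hBX N, hBX k] with ω h1 h2
        rw [h1, h2]
    rw [IndepFun_iff_Indep] at h3
    refine indep_of_indep_of_le_left h3 ?_
    refine iSup₂_le fun j hj => ?_
    rintro s ⟨t, ht, rfl⟩
    refine ⟨(fun x : Set.Iic k → ℝ => x ⟨j, hj⟩) ⁻¹' t, measurable_pi_apply _ ?_, rfl⟩
    rw [BorelSpace.measurable_eq (α := ℝ)]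
    exact ht
  · intro k hk
    refine ⟨nndist ((N * h : ℝ≥0) : ℝ) ((k * h : ℝ≥0) : ℝ), ?_⟩
    refine Eq.trans ?_ (hB.hasLaw_sub (N * h) (k * h)).map_eq
    refine Measure.map_congr ?_
    filter_upwards [hBX N, hBX k] with ω h1 h2
    simp [h1, h2]

theorem ProbabilityTheory.IsPreBrownianReal.lintegral_grid_range_sq_le
    (hB : IsPreBrownianReal B P) (h : ℝ≥0) (N : ℕ) :
    ∫⁻ ω, ((runningMax N fun j => B (j * h) ω : ℝ≥0∞) +
      (runningMax N fun j => -B (j * h) ω)) ^ 2 ∂P ≤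
      ENNReal.ofReal (4 * Real.log 2) * (N * h : ℝ≥0) := by
  have := hB.isGaussianProcess.isProbabilityMeasure
  obtain ⟨X, F, hX, hBX⟩ := hB.exists_isGaussianWalk h N
  have h1 := hX.lintegral_range_sq_le
  have hae : ∀ᵐ ω ∂P, ∀ k : ℕ, B (k * h) ω = X k ω := ae_all_iff.2 hBX
  rw [← hB.lintegral_sq]
  convert h1 using 1
  · refine lintegral_congr_ae ?_
    filter_upwards [hae] with ω hω
    simp_rw [hω]
  · congr 1
    refine lintegral_congr_ae ?_
    filter_upwards [hae] with ω hω
    rw [hω]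

end Law

/-- The supremum over the dyadic points of `[0, 1]` of the positive part of a path. -/
noncomputable def dyadicMax (f : ℝ≥0 → ℝ) : ℝ≥0∞ :=
  ⨆ m : ℕ, (runningMax (2 ^ m) (fun j => f (j * (2 ^ m)⁻¹)) : ℝ≥0∞)

theorem monotone_runningMax_dyadic (f : ℝ≥0 → ℝ) :
    Monotone fun m : ℕ => (runningMax (2 ^ m) (fun j => f (j * (2 ^ m)⁻¹)) : ℝ≥0∞) := by
  refine monotone_nat_of_le_succ fun m => ?_
  rw [ENNReal.coe_le_coe]
  unfold runningMax
  refine Finset.sup_le fun j hj => ?_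
  have hj' : 2 * j ∈ Finset.range (2 ^ (m + 1) + 1) := by
    simp only [Finset.mem_range, pow_succ] at *
    omega
  refine le_trans (le_of_eq ?_) (Finset.le_sup hj')
  have : ((2 * j : ℕ) : ℝ≥0) * (2 ^ (m + 1))⁻¹ = j * (2 ^ m)⁻¹ := by
    push_cast
    rw [pow_succ, mul_inv]
    calc (2 : ℝ≥0) * j * ((2 ^ m)⁻¹ * 2⁻¹) = j * (2 ^ m)⁻¹ * (2 * 2⁻¹) := by ring
      _ = _ := by rw [mul_inv_cancel₀ (by norm_num), mul_one]
  simp only [this]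

theorem ofReal_le_dyadicMax {f : ℝ≥0 → ℝ} (hf : Continuous f) {s : ℝ≥0} (hs : s ≤ 1) :
    ENNReal.ofReal (f s) ≤ dyadicMax f := by
  have h2 : Filter.Tendsto (fun m : ℕ => (2 : ℝ) ^ m) Filter.atTop Filter.atTop :=
    tendsto_pow_atTop_atTop_of_one_lt one_lt_two
  have ht : Filter.Tendsto (fun m : ℕ => ((⌊(s : ℝ) * 2 ^ m⌋₊ : ℝ≥0) * (2 ^ m)⁻¹)) Filter.atTop
      (nhds s) := by
    have := (tendsto_nat_floor_mul_div_atTop (R := ℝ) (a := s) s.2).comp h2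
    rw [← NNReal.tendsto_coe]
    simpa [Function.comp_def, div_eq_mul_inv] using this
  have hc : Filter.Tendsto (fun m : ℕ => ENNReal.ofReal (f ((⌊(s : ℝ) * 2 ^ m⌋₊ : ℝ≥0) * (2 ^ m)⁻¹)))
      Filter.atTop (nhds (ENNReal.ofReal (f s))) :=
    ((ENNReal.continuous_ofReal.comp hf).tendsto s).comp ht
  refine le_of_tendsto' hc fun m => ?_
  refine le_trans ?_ (le_iSup _ m)
  unfold runningMax ENNReal.ofReal
  rw [ENNReal.coe_le_coe]
  refine Finset.le_sup (f := fun j : ℕ => (f (j * (2 ^ m)⁻¹)).toNNReal) ?_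
  rw [Finset.mem_range, Nat.lt_succ_iff]
  have : ⌊(s : ℝ) * 2 ^ m⌋₊ ≤ ⌊((2 ^ m : ℕ) : ℝ)⌋₊ := by
    refine Nat.floor_mono ?_
    push_cast
    exact mul_le_of_le_one_left (by positivity) (by exact_mod_cast hs)
  rwa [Nat.floor_natCast] at this

section Law

variable {Ω : Type*} {mΩ : MeasurableSpace Ω} {B : ℝ≥0 → Ω → ℝ} {P : Measure Ω}

theorem aemeasurable_runningMax {X : ℕ → Ω → ℝ} (hX : ∀ k, AEMeasurable (X k) P) (N : ℕ) :
    AEMeasurable (fun ω => runningMax N fun j => X j ω) P := by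
  have hae : ∀ᵐ ω ∂P, ∀ k, X k ω = (hX k).mk _ ω := ae_all_iff.2 fun k => (hX k).ae_eq_mk
  refine ⟨_, measurable_runningMax (fun k => (hX k).measurable_mk) N, ?_⟩
  filter_upwards [hae] with ω hω
  simp_rw [hω]

/-- Monotone convergence along nested dyadic grids; each grid has `2 ^ m` steps of length `(2 ^
m)⁻¹`, hence the same bound. -/
theorem ProbabilityTheory.IsPreBrownianReal.lintegral_dyadicMax_sq_le
    (hB : IsPreBrownianReal B P) :
    ∫⁻ ω, (dyadicMax (fun t => B t ω) + dyadicMax (fun t => -B t ω)) ^ 2 ∂P ≤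
      ENNReal.ofReal (4 * Real.log 2) := by
  have hlim := lintegral_tendsto_of_tendsto_of_monotone (μ := P)
    (f := fun (m : ℕ) ω => ((runningMax (2 ^ m) fun j => B (j * (2 ^ m)⁻¹) ω : ℝ≥0∞) +
      (runningMax (2 ^ m) fun j => -B (j * (2 ^ m)⁻¹) ω)) ^ 2)
    (F := fun ω => (dyadicMax (fun t => B t ω) + dyadicMax (fun t => -B t ω)) ^ 2)
    (fun m => by
      have h1 := aemeasurable_runningMax (fun k : ℕ => hB.aemeasurable (k * (2 ^ m)⁻¹)) (2 ^ m)
      have h2 := aemeasurable_runningMax (fun k : ℕ => (hB.aemeasurable (k * (2 ^ m)⁻¹)).neg)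
        (2 ^ m)
      simp only [Pi.neg_apply] at h2
      fun_prop)
    (ae_of_all _ fun ω m m' hmm' => by
      have h1 := monotone_runningMax_dyadic (fun t => B t ω) hmm'
      have h2 := monotone_runningMax_dyadic (fun t => -B t ω) hmm'
      simp only at h1 h2 ⊢
      gcongr)
    (ae_of_all _ fun ω => by
      refine ENNReal.Tendsto.pow (Filter.Tendsto.add ?_ ?_)
      · exact tendsto_atTop_iSup (monotone_runningMax_dyadic fun t => B t ω)
      · exact tendsto_atTop_iSup (monotone_runningMax_dyadic fun t => -B t ω))
  refine le_of_tendsto' hlim fun m => ?_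
  refine (hB.lintegral_grid_range_sq_le (2 ^ m)⁻¹ (2 ^ m)).trans_eq ?_
  simp

end Law

/-! ### Circumradius of a path: box bound and countable description -/

theorem circumradius_le {n : ℕ} {K : Set (EuclideanSpace ℝ (Fin n))}
    {c : EuclideanSpace ℝ (Fin n)} {r : ℝ} (hr : 0 ≤ r) (h : K ⊆ Metric.closedBall c r) :
    circumradius K ≤ r :=
  csInf_le ⟨0, fun _ hx => hx.1⟩ ⟨hr, c, h⟩

theorem circumradius_nonneg {n : ℕ} (K : Set (EuclideanSpace ℝ (Fin n))) : 0 ≤ circumradius K :=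
  Real.sInf_nonneg fun _ hx => hx.1

theorem pathHull_subset_closedBall_iff {Ω : Type*} {n : ℕ}
    {W : ℝ≥0 → Ω → EuclideanSpace ℝ (Fin n)} {t : ℝ≥0} {ω : Ω} {c : EuclideanSpace ℝ (Fin n)}
    {r : ℝ} :
    pathHull W t ω ⊆ Metric.closedBall c r ↔ ∀ s ≤ t, dist (W s ω) c ≤ r := by
  unfold pathHull
  rw [(convex_closedBall c r).convexHull_subset_iff, Set.image_subset_iff]
  simp [Set.subset_def, Set.mem_Icc]

/-- The path stays in the box with sides `[-L j, U j]`, and the ball about the centre of the box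
with half the diagonal as radius contains it. -/
theorem ofReal_circumradius_sq_le {Ω : Type*} {n : ℕ} {W : ℝ≥0 → Ω → EuclideanSpace ℝ (Fin n)}
    {ω : Ω} (hW : ∀ j, Continuous fun t => W t ω j) :
    ENNReal.ofReal (circumradius (pathHull W 1 ω) ^ 2) ≤
      ∑ j, (dyadicMax (fun t => W t ω j) + dyadicMax (fun t => -W t ω j)) ^ 2 / 4 := by
  by_cases htop : ∀ j, dyadicMax (fun t => W t ω j) + dyadicMax (fun t => -W t ω j) ≠ ∞
  · have hU : ∀ j, ∃ u : ℝ≥0, dyadicMax (fun t => W t ω j) = u := fun j =>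
      ⟨_, (ENNReal.coe_toNNReal (ENNReal.add_ne_top.1 (htop j)).1).symm⟩
    have hL : ∀ j, ∃ u : ℝ≥0, dyadicMax (fun t => -W t ω j) = u := fun j =>
      ⟨_, (ENNReal.coe_toNNReal (ENNReal.add_ne_top.1 (htop j)).2).symm⟩
    choose U hU using hU
    choose L hL using hL
    have h1 : circumradius (pathHull W 1 ω) ≤ √(∑ j, (((U j : ℝ) + L j) / 2) ^ 2) := by
      refine circumradius_le (Real.sqrt_nonneg _)
        (c := WithLp.toLp 2 fun j => ((U j : ℝ) - L j) / 2) ?_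
      rw [pathHull_subset_closedBall_iff]
      intro s hs
      rw [EuclideanSpace.dist_eq]
      refine Real.sqrt_le_sqrt (Finset.sum_le_sum fun j _ => ?_)
      have a1 := ofReal_le_dyadicMax (hW j) hs
      have a2 := ofReal_le_dyadicMax (f := fun t => -W t ω j) (hW j).neg hs
      rw [hU j, ENNReal.ofReal_le_coe] at a1
      rw [hL j, ENNReal.ofReal_le_coe] at a2
      rw [Real.dist_eq, sq_abs]
      refine sq_le_sq' ?_ ?_ <;> simp only <;> linarith
    have h2 : circumradius (pathHull W 1 ω) ^ 2 ≤ ∑ j, (((U j : ℝ) + L j) / 2) ^ 2 := by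
      rw [← Real.sq_sqrt (Finset.sum_nonneg fun j _ => sq_nonneg _ :
        0 ≤ ∑ j, (((U j : ℝ) + L j) / 2) ^ 2)]
      have := circumradius_nonneg (pathHull W 1 ω)
      gcongr
    refine (ENNReal.ofReal_le_ofReal h2).trans_eq ?_
    rw [ENNReal.ofReal_sum_of_nonneg fun j _ => sq_nonneg _]
    refine Finset.sum_congr rfl fun j _ => ?_
    rw [hU j, hL j, show (((U j : ℝ) + L j) / 2) ^ 2 = (((U j + L j) ^ 2 / 4 : ℝ≥0) : ℝ) by
      push_cast; ring, ENNReal.ofReal_coe_nnreal, ENNReal.coe_div (by norm_num)]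
    push_cast
    rfl
  · push Not at htop
    obtain ⟨j, hj⟩ := htop
    refine le_top.trans_eq (Eq.symm ?_)
    rw [ENNReal.sum_eq_top]
    refine ⟨j, Finset.mem_univ _, ?_⟩
    rw [hj]
    simp [ENNReal.top_div]

/-- A countable dense family of times in `[0, 1]`, containing all `j / k` with `j ≤ k`. -/
noncomputable def unitTime (p : ℕ × ℕ) : ℝ≥0 := min 1 (p.1 * (p.2 : ℝ≥0)⁻¹)

theorem unitTime_le_one (p : ℕ × ℕ) : unitTime p ≤ 1 := min_le_left _ _

theorem exists_tendsto_unitTime {s : ℝ≥0} (hs : s ≤ 1) :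
    ∃ p : ℕ → ℕ × ℕ, Filter.Tendsto (fun m => unitTime (p m)) Filter.atTop (nhds s) := by
  refine ⟨fun m => (⌊(s : ℝ) * m⌋₊, m), ?_⟩
  have h2 : Filter.Tendsto (fun m : ℕ => (m : ℝ)) Filter.atTop Filter.atTop :=
    tendsto_natCast_atTop_atTop
  have ht : Filter.Tendsto (fun m : ℕ => ((⌊(s : ℝ) * m⌋₊ : ℝ≥0) * (m : ℝ≥0)⁻¹)) Filter.atTop
      (nhds s) := by
    have := (tendsto_nat_floor_mul_div_atTop (R := ℝ) (a := s) s.2).comp h2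
    rw [← NNReal.tendsto_coe]
    simpa [Function.comp_def, div_eq_mul_inv] using this
  have := (tendsto_const_nhds (x := (1 : ℝ≥0))).min ht
  rwa [min_eq_right hs] at this

theorem Continuous.le_of_forall_unitTime_le {α : Type*} [TopologicalSpace α] [Preorder α]
    [OrderClosedTopology α] {g : ℝ≥0 → α} (hg : Continuous g) {r : α}
    (h : ∀ p, g (unitTime p) ≤ r) {s : ℝ≥0} (hs : s ≤ 1) : g s ≤ r := by
  obtain ⟨p, hp⟩ := exists_tendsto_unitTime hs
  exact le_of_tendsto' ((hg.tendsto s).comp hp) fun m => h (p m)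

section

variable {Ω : Type*} {n : ℕ} {W : ℝ≥0 → Ω → EuclideanSpace ℝ (Fin n)} {ω : Ω}

theorem exists_pathHull_subset_closedBall (hW : Continuous fun t => W t ω) :
    {r : ℝ | 0 ≤ r ∧ ∃ c, pathHull W 1 ω ⊆ Metric.closedBall c r}.Nonempty := by
  have hb : Bornology.IsBounded ((fun s => W s ω) '' Set.Icc 0 1) :=
    (isCompact_Icc.image hW).isBounded
  obtain ⟨r, hr0, hr⟩ := hb.subset_closedBall_lt 0 0
  exact ⟨r, hr0.le, 0, convexHull_min hr (convex_closedBall _ _)⟩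

/-- Serves measurability: density of the centres and continuity of the path reduce the infimum and
the supremum to countable ones. -/
theorem ofReal_circumradius_eq (hW : Continuous fun t => W t ω) :
    ENNReal.ofReal (circumradius (pathHull W 1 ω)) =
      ⨅ i : ℕ, ⨆ p, edist (W (unitTime p) ω)
        (TopologicalSpace.denseSeq (EuclideanSpace ℝ (Fin n)) i) := by
  apply le_antisymm
  · refine le_iInf fun i => ?_
    set c := TopologicalSpace.denseSeq (EuclideanSpace ℝ (Fin n)) i
    by_cases htop : ⨆ p, edist (W (unitTime p) ω) c = ∞
    · rw [htop]; exact le_top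
    · refine ENNReal.ofReal_le_of_le_toReal ?_
      refine circumradius_le (c := c) ENNReal.toReal_nonneg ?_
      rw [pathHull_subset_closedBall_iff]
      intro s hs
      rw [dist_edist]
      refine ENNReal.toReal_mono htop ?_
      exact Continuous.le_of_forall_unitTime_le (g := fun t => edist (W t ω) c)
        (hW.edist continuous_const)
        (fun p => le_iSup (fun p => edist (W (unitTime p) ω) c) p) hs
  · refine ENNReal.le_of_forall_pos_le_add fun ε hε _ => ?_
    have hε2 : (0 : ℝ) < ε / 2 := by positivity
    obtain ⟨r, ⟨hr0, c, hc⟩, hr⟩ := exists_lt_of_csInf_lt (exists_pathHull_subset_closedBall hW)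
      (lt_add_of_pos_right (circumradius (pathHull W 1 ω)) hε2)
    obtain ⟨i, hi⟩ := (TopologicalSpace.denseRange_denseSeq
      (EuclideanSpace ℝ (Fin n))).exists_dist_lt c hε2
    refine (iInf_le _ i).trans (iSup_le fun p => ?_)
    rw [pathHull_subset_closedBall_iff] at hc
    rw [edist_dist, ← ENNReal.ofReal_coe_nnreal (p := ε),
      ← ENNReal.ofReal_add (circumradius_nonneg _) ε.coe_nonneg]
    refine ENNReal.ofReal_le_ofReal ?_
    have h1 := hc _ (unitTime_le_one p)
    have h2 := dist_triangle (W (unitTime p) ω) c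
      (TopologicalSpace.denseSeq (EuclideanSpace ℝ (Fin n)) i)
    linarith

end

theorem EuclideanSpace.continuous_iff {α : Type*} [TopologicalSpace α] {n : ℕ}
    {f : α → EuclideanSpace ℝ (Fin n)} : Continuous f ↔ ∀ j, Continuous fun t => f t j := by
  rw [← (PiLp.homeomorph 2 fun _ : Fin n => ℝ).comp_continuous_iff, continuous_pi_iff]
  rfl

/-! ### Integrability and the upper bound -/

namespace IsBrownianMotion

variable {Ω : Type*} {mΩ : MeasurableSpace Ω} {P : Measure Ω} {n : ℕ}
  {W : ℝ≥0 → Ω → EuclideanSpace ℝ (Fin n)}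

theorem ae_continuous_coord (hW : IsBrownianMotion W P) :
    ∀ᵐ ω ∂P, ∀ j, Continuous fun t => W t ω j :=
  ae_all_iff.2 fun j => (hW.isBrownianReal_coord j).cont

theorem ae_continuous (hW : IsBrownianMotion W P) : ∀ᵐ ω ∂P, Continuous fun t => W t ω := by
  filter_upwards [hW.ae_continuous_coord] with ω hω
  exact EuclideanSpace.continuous_iff.2 hω

theorem aemeasurable (hW : IsBrownianMotion W P) (t : ℝ≥0) : AEMeasurable (W t) P :=
  (WithLp.measurable_toLp 2 (Fin n → ℝ)).comp_aemeasurable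
    (aemeasurable_pi_lambda _ fun j => (hW.isBrownianReal_coord j).aemeasurable t)

theorem aemeasurable_circumradius (hW : IsBrownianMotion W P) :
    AEMeasurable (fun ω => circumradius (pathHull W 1 ω)) P := by
  have h : AEMeasurable (fun ω => ⨅ i : ℕ, ⨆ p, edist (W (unitTime p) ω)
      (TopologicalSpace.denseSeq (EuclideanSpace ℝ (Fin n)) i)) P :=
    AEMeasurable.iInf fun i => AEMeasurable.iSup fun p =>
      (hW.aemeasurable _).edist aemeasurable_const
  refine h.ennreal_toReal.congr ?_
  filter_upwards [hW.ae_continuous] with ω hω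
  rw [← ofReal_circumradius_eq hω, ENNReal.toReal_ofReal (circumradius_nonneg _)]

theorem lintegral_circumradius_sq_le (hW : IsBrownianMotion W P) :
    ∫⁻ ω, ENNReal.ofReal (circumradius (pathHull W 1 ω) ^ 2) ∂P ≤
      ENNReal.ofReal (n * Real.log 2) := by
  have hlog : 0 ≤ Real.log 2 := Real.log_nonneg (by norm_num)
  have hm : ∀ j, AEMeasurable (fun ω => dyadicMax (fun t => W t ω j) +
      dyadicMax (fun t => -W t ω j)) P := by
    intro j
    have hB := (hW.isBrownianReal_coord j).aemeasurable
    refine AEMeasurable.add ?_ ?_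
    · exact AEMeasurable.iSup fun m => (aemeasurable_runningMax
        (fun k : ℕ => hB (k * (2 ^ m)⁻¹)) (2 ^ m)).coe_nnreal_ennreal
    · exact AEMeasurable.iSup fun m => (aemeasurable_runningMax
        (fun k : ℕ => (hB (k * (2 ^ m)⁻¹)).neg) (2 ^ m)).coe_nnreal_ennreal
  calc ∫⁻ ω, ENNReal.ofReal (circumradius (pathHull W 1 ω) ^ 2) ∂P
      ≤ ∫⁻ ω, ∑ j, (dyadicMax (fun t => W t ω j) + dyadicMax (fun t => -W t ω j)) ^ 2 / 4 ∂P := by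
        refine lintegral_mono_ae ?_
        filter_upwards [hW.ae_continuous_coord] with ω hω
        exact ofReal_circumradius_sq_le hω
    _ = ∑ j, ∫⁻ ω, (dyadicMax (fun t => W t ω j) + dyadicMax (fun t => -W t ω j)) ^ 2 / 4 ∂P :=
        lintegral_finsetSum' _ fun j _ => ((hm j).pow_const 2).div_const 4
    _ ≤ ∑ j : Fin n, ENNReal.ofReal (Real.log 2) := by
        refine Finset.sum_le_sum fun j _ => ?_
        simp_rw [div_eq_mul_inv]
        rw [lintegral_mul_const' _ _ (by simp)]
        have := (hW.isBrownianReal_coord j).toIsPreBrownianReal.lintegral_dyadicMax_sq_le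
        refine (mul_le_mul_left this _).trans_eq ?_
        rw [ENNReal.ofReal_mul (by norm_num), mul_right_comm]
        rw [show ENNReal.ofReal 4 = 4 by simp, ENNReal.mul_inv_cancel (by simp) (by simp), one_mul]
    _ = _ := by
        rw [ENNReal.ofReal_mul (by positivity)]
        simp

theorem memLp_circumradius (hW : IsBrownianMotion W P) :
    MemLp (fun ω => circumradius (pathHull W 1 ω)) 2 P := by
  rw [memLp_two_iff_integrable_sq hW.aemeasurable_circumradius.aestronglyMeasurable]
  refine ⟨(hW.aemeasurable_circumradius.pow_const 2).aestronglyMeasurable, ?_⟩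
  rw [hasFiniteIntegral_iff_ofReal (ae_of_all _ fun ω => sq_nonneg _)]
  exact hW.lintegral_circumradius_sq_le.trans_lt ENNReal.ofReal_lt_top

theorem integral_circumradius_le [IsProbabilityMeasure P] (hn : 1 ≤ n)
    (hW : IsBrownianMotion W P) :
    ∫ ω, circumradius (pathHull W 1 ω) ∂P ≤ √(Real.log 2) * √(n : ℝ) := by
  have hlog : 0 < Real.log 2 := Real.log_pos (by norm_num)
  have hn' : (0 : ℝ) < n := by exact_mod_cast hn
  have hmem := hW.memLp_circumradius
  have hsq : ∫ ω, circumradius (pathHull W 1 ω) ^ 2 ∂P ≤ n * Real.log 2 := by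
    rw [integral_eq_lintegral_of_nonneg_ae (ae_of_all _ fun ω => sq_nonneg _)
      hmem.integrable_sq.aestronglyMeasurable]
    exact ENNReal.toReal_le_of_le_ofReal (by positivity) hW.lintegral_circumradius_sq_le
  set c := √(Real.log 2) * √(n : ℝ) with hc
  have hc0 : 0 < c := by positivity
  have hc2 : c ^ 2 = n * Real.log 2 := by
    rw [hc, mul_pow, Real.sq_sqrt hlog.le, Real.sq_sqrt hn'.le, mul_comm]
  -- Integrating `2 * c * R ≤ R ^ 2 + c ^ 2` with `c ^ 2 = n * log 2` replaces the Cauchy–Schwarz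
  -- inequality.
  have h1 : ∫ ω, 2 * c * circumradius (pathHull W 1 ω) ∂P ≤
      ∫ ω, (circumradius (pathHull W 1 ω) ^ 2 + c ^ 2) ∂P := by
    refine integral_mono ((hmem.integrable (by norm_num)).const_mul _)
      (hmem.integrable_sq.add (integrable_const _)) fun ω => ?_
    simp only
    nlinarith [sq_nonneg (circumradius (pathHull W 1 ω) - c)]
  rw [integral_const_mul, integral_add hmem.integrable_sq (integrable_const _)] at h1
  simp only [integral_const, probReal_univ, one_smul] at h1
  nlinarith

end IsBrownianMotion

/-! ### Scaling, the squared-norm martingale and fourth moments -/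

theorem ProbabilityTheory.IndepFun.prodMk_right_of_prodMk_left {Ω α β γ : Type*}
    {mΩ : MeasurableSpace Ω} [MeasurableSpace α] [MeasurableSpace β] [MeasurableSpace γ]
    {P : Measure Ω} [IsFiniteMeasure P] {X : Ω → α} {Y : Ω → β} {Z : Ω → γ}
    (hX : AEMeasurable X P) (hY : AEMeasurable Y P) (hZ : AEMeasurable Z P)
    (hXY : IndepFun X Y P) (hXYZ : IndepFun (fun ω => (X ω, Y ω)) Z P) :
    IndepFun X (fun ω => (Y ω, Z ω)) P := by
  have hYZ : IndepFun Y Z P := hXYZ.comp measurable_snd measurable_id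
  rw [indepFun_iff_map_prod_eq_prod_map_map hX (hY.prodMk hZ),
    (indepFun_iff_map_prod_eq_prod_map_map hY hZ).1 hYZ,
    ← (measurePreserving_prodAssoc (P.map X) (P.map Y) (P.map Z)).map_eq,
    ← (indepFun_iff_map_prod_eq_prod_map_map hX hY).1 hXY,
    ← (indepFun_iff_map_prod_eq_prod_map_map (hX.prodMk hY) hZ).1 hXYZ,
    AEMeasurable.map_map_of_aemeasurable (by fun_prop) ((hX.prodMk hY).prodMk hZ)]
  rfl

theorem integral_pow_four_gaussianReal (v : ℝ≥0) :
    ∫ x, x ^ 4 ∂gaussianReal 0 v = (v : ℝ) ^ 2 * ∫ x, x ^ 4 ∂gaussianReal 0 1 := by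
  have h := gaussianReal_map_const_mul (μ := 0) (v := 1) (√(v : ℝ))
  have e : NNReal.mk (√(v : ℝ) ^ 2) (sq_nonneg _) * 1 = v := by
    ext; simp
  rw [e, mul_zero] at h
  rw [← h, integral_map (by fun_prop) (by fun_prop), ← integral_const_mul]
  congr 1
  ext x
  rw [mul_pow, show (√(v : ℝ)) ^ 4 = (√(v : ℝ) ^ 2) ^ 2 by ring, Real.sq_sqrt v.coe_nonneg]

theorem integrable_pow_four_gaussianReal (v : ℝ≥0) :
    Integrable (fun x : ℝ => x ^ 4) (gaussianReal 0 v) := by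
  have h : MemLp (id : ℝ → ℝ) ((4 : ℕ) : ℝ≥0∞) (gaussianReal 0 v) := by
    simpa using memLp_id_gaussianReal (μ := 0) (v := v) 4
  have := h.integrable_norm_pow (by norm_num)
  refine this.congr (ae_of_all _ fun x => ?_)
  simp only [id, Real.norm_eq_abs]
  exact Even.pow_abs (by decide) x

namespace IsBrownianMotion

variable {Ω : Type*} {mΩ : MeasurableSpace Ω} {P : Measure Ω} {n : ℕ}
  {W : ℝ≥0 → Ω → EuclideanSpace ℝ (Fin n)}

theorem smul (hW : IsBrownianMotion W P) {c : ℝ≥0} (hc : c ≠ 0) :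
    IsBrownianMotion (fun t ω => (√(c : ℝ))⁻¹ • W (c * t) ω) P where
  isBrownianReal_coord j := by
    simpa using (hW.isBrownianReal_coord j).smul hc
  iIndepFun_coord := by
    have := hW.iIndepFun_coord.comp (fun _ x t => (√(c : ℝ))⁻¹ * x (c * t))
      (fun _ => measurable_pi_lambda _ fun t => (measurable_pi_apply _).const_mul _)
    exact this

/-- The law of a Brownian motion observed along a countable family of times. -/
theorem map_comp_eq [IsProbabilityMeasure P] {V : ℝ≥0 → Ω → EuclideanSpace ℝ (Fin n)}
    (hW : IsBrownianMotion W P) (hV : IsBrownianMotion V P) {κ : Type*} [Countable κ]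
    (u : κ → ℝ≥0) :
    P.map (fun ω (i : Fin n) (p : κ) => W (u p) ω i) =
      P.map (fun ω (i : Fin n) (p : κ) => V (u p) ω i) := by
  have hm : ∀ {U : ℝ≥0 → Ω → EuclideanSpace ℝ (Fin n)}, IsBrownianMotion U P → ∀ i : Fin n,
      AEMeasurable (fun ω (p : κ) => U (u p) ω i) P := fun hU i =>
    aemeasurable_pi_lambda _ fun p => (hU.isBrownianReal_coord i).aemeasurable _
  have hind : ∀ {U : ℝ≥0 → Ω → EuclideanSpace ℝ (Fin n)}, IsBrownianMotion U P →
      iIndepFun (fun (i : Fin n) ω (p : κ) => U (u p) ω i) P := fun hU =>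
    hU.iIndepFun_coord.comp (fun _ x p => x (u p))
      (fun _ => measurable_pi_lambda _ fun p => measurable_pi_apply _)
  rw [(iIndepFun_iff_map_fun_eq_pi_map (hm hW)).1 (hind hW),
    (iIndepFun_iff_map_fun_eq_pi_map (hm hV)).1 (hind hV)]
  congr 1
  ext1 i
  rw [map_eq_iff_forall_finset_map_restrict_eq (X := fun p ω => W (u p) ω i)
    (Y := fun p ω => V (u p) ω i) (hm hW i) (hm hV i)]
  intro I
  classical
  -- Times may repeat in `u`, so the finite-dimensional law is taken on the image of `I` and pulled
  -- back.
  have key : ∀ {U : ℝ≥0 → Ω → EuclideanSpace ℝ (Fin n)}, IsBrownianMotion U P →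
      P.map (fun ω => I.restrict fun p => U (u p) ω i) =
        (BrownianReal.projectiveFamily (I.image u)).map
          fun x (p : I) => x ⟨u p, Finset.mem_image_of_mem u p.2⟩ := by
    intro U hU
    have h := (hU.isBrownianReal_coord i).hasLaw (I.image u)
    rw [← h.map_eq, AEMeasurable.map_map_of_aemeasurable
      (Measurable.aemeasurable (measurable_pi_lambda _ fun p => measurable_pi_apply _))
      h.aemeasurable]
    rfl
  rw [key hW, key hV]

/-- The increments of a coordinate are independent of the past of all coordinates. -/
theorem indepFun_increment [IsProbabilityMeasure P] (hW : IsBrownianMotion W P) (s t : ℝ≥0)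
    {κ : Type*} [Countable κ] (u : κ → ℝ≥0) (hu : ∀ p, u p ≤ s) (i : Fin n) :
    IndepFun (fun ω => W (s + t) ω i - W s ω i) (fun ω (j : Fin n) (p : κ) => W (u p) ω j) P := by
  have hm : ∀ j t, AEMeasurable (fun ω => W t ω j) P := fun j t =>
    (hW.isBrownianReal_coord j).aemeasurable t
  have h1 : IndepFun (fun ω => W (s + t) ω i - W s ω i) (fun ω (p : κ) => W (u p) ω i) P := by
    have h := (hW.isBrownianReal_coord i).indepFun_shift s
    have hφ : Measurable fun x : ℝ≥0 → ℝ => x t := measurable_pi_apply _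
    have hψ : Measurable fun (x : Set.Iic s → ℝ) (p : κ) => x ⟨u p, hu p⟩ :=
      measurable_pi_lambda _ fun _ => measurable_pi_apply _
    exact h.comp hφ hψ
  have h2 : iIndepFun (fun (j : Fin n) ω => (W (s + t) ω j - W s ω j, fun p : κ => W (u p) ω j))
      P := by
    have hφ : Measurable fun x : ℝ≥0 → ℝ => (x (s + t) - x s, fun p : κ => x (u p)) :=
      ((measurable_pi_apply (s + t)).sub (measurable_pi_apply s)).prodMk
        (measurable_pi_lambda _ fun p => measurable_pi_apply (u p))
    exact hW.iIndepFun_coord.comp (fun _ x => (x (s + t) - x s, fun p : κ => x (u p))) fun _ => hφ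
  have hm2 : ∀ j : Fin n, AEMeasurable (fun ω => (W (s + t) ω j - W s ω j,
      fun p : κ => W (u p) ω j)) P := fun j =>
    ((hm j _).sub (hm j _)).prodMk (aemeasurable_pi_lambda _ fun p => hm j _)
  have h3 := h2.indepFun_finset₀ {i} {i}ᶜ disjoint_compl_right hm2
  have hφ : Measurable fun x : ({i} : Finset (Fin n)) → ℝ × (κ → ℝ) =>
      x ⟨i, Finset.mem_singleton_self i⟩ := measurable_pi_apply _
  have hψ : Measurable fun (x : (({i}ᶜ : Finset (Fin n)) → ℝ × (κ → ℝ)))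
      (j : ({i}ᶜ : Finset (Fin n))) => (x j).2 :=
    measurable_pi_lambda _ fun j => measurable_snd.comp (measurable_pi_apply _)
  have h4 := h3.comp hφ hψ
  -- The increment is independent of the past of its own coordinate (`h1`), and both together are
  -- independent of the other coordinates (`h4`); `hχ` then reassembles the whole past.
  have h5 := IndepFun.prodMk_right_of_prodMk_left ((hm i _).sub (hm i _))
    (aemeasurable_pi_lambda _ fun p => hm i _)
    (aemeasurable_pi_lambda _ fun j => aemeasurable_pi_lambda _ fun p => hm _ _) h1 h4
  have hχ : Measurable fun (x : (κ → ℝ) × (({i}ᶜ : Finset (Fin n)) → κ → ℝ)) (j : Fin n) =>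
      if hj : j = i then x.1 else x.2 ⟨j, by simpa using hj⟩ := by
    refine measurable_pi_lambda _ fun j => ?_
    by_cases hj : j = i
    · simpa [hj] using measurable_fst
    · simp only [hj, dite_false]
      exact (measurable_pi_apply _).comp measurable_snd
  have h6 := h5.comp measurable_id hχ
  refine h6.congr (Filter.EventuallyEq.refl _ _) (Filter.Eventually.of_forall fun ω => ?_)
  ext j p
  by_cases hj : j = i
  · subst hj; simp
  · simp [hj]

/-- `‖W t‖ ^ 2 - n * t` is a martingale, tested against events of the past. -/
theorem integral_indicator_norm_sq_sub [IsProbabilityMeasure P] (hW : IsBrownianMotion W P)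
    (s t : ℝ≥0) {κ : Type*} [Countable κ] (u : κ → ℝ≥0) (hu : ∀ p, u p ≤ s)
    {C : Set (Fin n → κ → ℝ)} (hC : MeasurableSet C) (p₀ : κ) (hp₀ : u p₀ = s) :
    Integrable (fun ω => C.indicator (fun _ => (1 : ℝ)) (fun j p => W (u p) ω j) *
      (‖W (s + t) ω‖ ^ 2 - ‖W s ω‖ ^ 2)) P ∧
    ∫ ω, C.indicator (fun _ => (1 : ℝ)) (fun j p => W (u p) ω j) *
      (‖W (s + t) ω‖ ^ 2 - ‖W s ω‖ ^ 2) ∂P =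
      n * t * ∫ ω, C.indicator (fun _ => (1 : ℝ)) (fun j p => W (u p) ω j) ∂P := by
  set I : Ω → ℝ := fun ω => C.indicator (fun _ => (1 : ℝ)) (fun j p => W (u p) ω j) with hI
  have hpm : AEMeasurable (fun ω (j : Fin n) (p : κ) => W (u p) ω j) P := aemeasurable_pi_lambda _ fun j =>
    aemeasurable_pi_lambda _ fun p => (hW.isBrownianReal_coord j).aemeasurable _
  have hCm : Measurable (C.indicator fun _ => (1 : ℝ)) := measurable_const.indicator hC
  have hIm : AEMeasurable I P := hCm.comp_aemeasurable hpm
  have hIb : ∀ ω, ‖I ω‖ ≤ 1 := by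
    intro ω
    simp only [hI, Set.indicator]
    split_ifs <;> simp
  have hIint : Integrable I P := Integrable.of_bound hIm.aestronglyMeasurable 1
    (ae_of_all _ hIb)
  have key : ∀ i : Fin n, Integrable (fun ω => I ω * (W (s + t) ω i ^ 2 - W s ω i ^ 2)) P ∧
      ∫ ω, I ω * (W (s + t) ω i ^ 2 - W s ω i ^ 2) ∂P = t * ∫ ω, I ω ∂P := by
    intro i
    have hB := (hW.isBrownianReal_coord i).toIsPreBrownianReal
    have hind := hW.indepFun_increment s t u hu i
    have hlaw := (hB.shift s).hasLaw_eval t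
    have hΔ2 : MemLp (fun ω => W (s + t) ω i - W s ω i) 2 P :=
      hlaw.hasGaussianLaw.memLp_two
    have hΔ : Integrable (fun ω => W (s + t) ω i - W s ω i) P := hΔ2.integrable (by norm_num)
    have hΔ0 : ∫ ω, (W (s + t) ω i - W s ω i) ∂P = 0 := (hB.shift s).integral_eval t
    have hΔsq : ∫ ω, (W (s + t) ω i - W s ω i) ^ 2 ∂P = t := by
      rw [integral_eq_lintegral_of_nonneg_ae (ae_of_all _ fun ω => sq_nonneg _)
        hΔ2.integrable_sq.aestronglyMeasurable, (hB.shift s).lintegral_sq t]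
      simp
    have hWs : Integrable (fun ω => W s ω i) P := hB.integrable_eval s
    have hIW : Integrable (fun ω => I ω * W s ω i) P :=
      hWs.bdd_mul hIm.aestronglyMeasurable (ae_of_all _ hIb)
    have i1 : IndepFun (fun ω => I ω * W s ω i) (fun ω => W (s + t) ω i - W s ω i) P := by
      have hφ : Measurable fun x : Fin n → κ → ℝ => C.indicator (fun _ => (1 : ℝ)) x * x i p₀ :=
        hCm.mul ((measurable_pi_apply _).comp (measurable_pi_apply _))
      have := hind.symm.comp hφ measurable_id
      refine this.congr (Filter.Eventually.of_forall fun ω => ?_) (Filter.EventuallyEq.refl _ _)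
      simp only [Function.comp, hI, hp₀]
    have i2 : IndepFun I (fun ω => (W (s + t) ω i - W s ω i) ^ 2) P :=
      hind.symm.comp hCm (measurable_id.pow_const 2)
    have g1 : Integrable (fun ω => (I ω * W s ω i) * (W (s + t) ω i - W s ω i)) P :=
      i1.integrable_mul hIW hΔ
    have g2 : Integrable (fun ω => I ω * (W (s + t) ω i - W s ω i) ^ 2) P :=
      i2.integrable_mul hIint hΔ2.integrable_sq
    have e1 := i1.integral_fun_mul_eq_mul_integral hIW.aestronglyMeasurable
      hΔ.aestronglyMeasurable
    have e2 := i2.integral_fun_mul_eq_mul_integral hIint.aestronglyMeasurable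
      hΔ2.integrable_sq.aestronglyMeasurable
    -- The first term has mean zero by independence and centering; the second contributes the
    -- variance `t`. The index `p₀` makes `W s` part of the observed past.
    have e3 : ∀ ω, I ω * (W (s + t) ω i ^ 2 - W s ω i ^ 2) =
        2 * ((I ω * W s ω i) * (W (s + t) ω i - W s ω i)) +
          I ω * (W (s + t) ω i - W s ω i) ^ 2 := fun ω => by ring
    simp_rw [e3]
    refine ⟨(g1.const_mul 2).add g2, ?_⟩
    rw [integral_add (g1.const_mul 2) g2, integral_const_mul, e1, e2, hΔ0, hΔsq]
    ring
  have e : ∀ ω, I ω * (‖W (s + t) ω‖ ^ 2 - ‖W s ω‖ ^ 2) =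
      ∑ i, I ω * (W (s + t) ω i ^ 2 - W s ω i ^ 2) := by
    intro ω
    rw [EuclideanSpace.real_norm_sq_eq, EuclideanSpace.real_norm_sq_eq, ← Finset.sum_sub_distrib,
      Finset.mul_sum]
  change Integrable (fun ω => I ω * (‖W (s + t) ω‖ ^ 2 - ‖W s ω‖ ^ 2)) P ∧
    ∫ ω, I ω * (‖W (s + t) ω‖ ^ 2 - ‖W s ω‖ ^ 2) ∂P = n * t * ∫ ω, I ω ∂P
  simp_rw [e]
  refine ⟨integrable_finsetSum _ fun i _ => (key i).1, ?_⟩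
  rw [integral_finsetSum _ fun i _ => (key i).1]
  simp_rw [(key _).2]
  simp [mul_assoc]

/-- The order `t ^ 2` is what matters: over `N` steps of length `3 / N` the total is of order `1 /
N`, so the overshoot disappears in the limit. -/
theorem integral_norm_increment_pow_four_le [IsProbabilityMeasure P] (hW : IsBrownianMotion W P)
    (s t : ℝ≥0) :
    Integrable (fun ω => ‖W (s + t) ω - W s ω‖ ^ 4) P ∧
    ∫ ω, ‖W (s + t) ω - W s ω‖ ^ 4 ∂P ≤ n ^ 2 * t ^ 2 * ∫ x, x ^ 4 ∂gaussianReal 0 1 := by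
  have key : ∀ i : Fin n, Integrable (fun ω => (W (s + t) ω i - W s ω i) ^ 4) P ∧
      ∫ ω, (W (s + t) ω i - W s ω i) ^ 4 ∂P = t ^ 2 * ∫ x, x ^ 4 ∂gaussianReal 0 1 := by
    intro i
    have hlaw := ((hW.isBrownianReal_coord i).toIsPreBrownianReal.shift s).hasLaw_eval t
    constructor
    · have := integrable_pow_four_gaussianReal t
      rw [← hlaw.map_eq] at this
      exact this.comp_aemeasurable hlaw.aemeasurable
    · rw [← integral_pow_four_gaussianReal, ← hlaw.integral_comp (by fun_prop)]
      rfl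
  have hle : ∀ ω, ‖W (s + t) ω - W s ω‖ ^ 4 ≤ n * ∑ i, (W (s + t) ω i - W s ω i) ^ 4 := by
    intro ω
    have h1 : ‖W (s + t) ω - W s ω‖ ^ 4 = (∑ i, (W (s + t) ω i - W s ω i) ^ 2) ^ 2 := by
      rw [show ‖W (s + t) ω - W s ω‖ ^ 4 = (‖W (s + t) ω - W s ω‖ ^ 2) ^ 2 by ring,
        EuclideanSpace.real_norm_sq_eq]
      rfl
    rw [h1]
    refine sq_sum_le_card_mul_sum_sq.trans_eq ?_
    simp [← pow_mul]
  have hint : Integrable (fun ω => (n : ℝ) * ∑ i, (W (s + t) ω i - W s ω i) ^ 4) P :=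
    (integrable_finsetSum _ fun i _ => (key i).1).const_mul _
  have hint2 : Integrable (fun ω => ‖W (s + t) ω - W s ω‖ ^ 4) P := by
    refine hint.mono' ?_ (ae_of_all _ fun ω => ?_)
    · exact (((hW.aemeasurable _).sub (hW.aemeasurable _)).norm.pow_const 4).aestronglyMeasurable
    · rw [Real.norm_of_nonneg (by positivity)]
      exact hle ω
  refine ⟨hint2, (integral_mono hint2 hint hle).trans_eq ?_⟩
  rw [integral_const_mul, integral_finsetSum _ fun i _ => (key i).1]
  simp_rw [(key _).2]
  simp
  ring

end IsBrownianMotion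

/-! ### Deterministic inequalities for stopped sums and the tangent line -/

section Pathwise

variable {E : Type*} [NormedAddCommGroup E]

/-- Completing the square twice: first the cross term is absorbed into `η` and a multiple of `x ^
2`, then `x ^ 2` into `η` and a multiple of `x ^ 4`. -/
theorem add_sq_le_of_pos {r x η : ℝ} (hη : 0 < η) :
    (r + x) ^ 2 ≤ r ^ 2 + 2 * η + (r ^ 2 / η + 1) ^ 2 / (4 * η) * x ^ 4 := by
  have h1 : 2 * r * x ≤ η + r ^ 2 / η * x ^ 2 := by
    have : η + r ^ 2 / η * x ^ 2 - 2 * r * x = (η - r * x) ^ 2 / η := by field_simp; ring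
    have h : 0 ≤ (η - r * x) ^ 2 / η := by positivity
    linarith
  have h2 : ∀ c : ℝ, c * x ^ 2 ≤ η + c ^ 2 / (4 * η) * x ^ 4 := by
    intro c
    have : η + c ^ 2 / (4 * η) * x ^ 4 - c * x ^ 2 = (2 * η - c * x ^ 2) ^ 2 / (4 * η) := by
      field_simp; ring
    have h : 0 ≤ (2 * η - c * x ^ 2) ^ 2 / (4 * η) := by positivity
    linarith
  have h3 := h2 (r ^ 2 / η + 1)
  nlinarith

open Classical in
/-- The squared norm at the exit from a ball exceeds the squared radius only by the overshoot. -/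
theorem sum_stopped_increments_le (s : ℕ → E) {r η : ℝ} (hr : 0 ≤ r) (hη : 0 < η) (N : ℕ) :
    ∑ k ∈ Finset.range N, (if ∀ j ≤ k, ‖s j‖ ^ 2 < r ^ 2 then (1 : ℝ) else 0) *
      (‖s (k + 1)‖ ^ 2 - ‖s k‖ ^ 2) ≤
      r ^ 2 + 2 * η + (r ^ 2 / η + 1) ^ 2 / (4 * η) *
        ∑ k ∈ Finset.range N, ‖s (k + 1) - s k‖ ^ 4 := by
  have htel : ∀ m : ℕ, (∀ j < m, ‖s j‖ ^ 2 < r ^ 2) →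
      ∑ k ∈ Finset.range m, (if ∀ j ≤ k, ‖s j‖ ^ 2 < r ^ 2 then (1 : ℝ) else 0) *
        (‖s (k + 1)‖ ^ 2 - ‖s k‖ ^ 2) = ‖s m‖ ^ 2 - ‖s 0‖ ^ 2 := by
    intro m hm
    rw [← Finset.sum_range_sub (fun k => ‖s k‖ ^ 2)]
    refine Finset.sum_congr rfl fun k hk => ?_
    rw [if_pos fun j hj => hm j (hj.trans_lt (Finset.mem_range.1 hk)), one_mul]
  set c := (r ^ 2 / η + 1) ^ 2 / (4 * η) with hc
  have hc0 : 0 ≤ c := by positivity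
  induction N with
  | zero => simp; positivity
  | succ m ih =>
    by_cases hm : ∀ j ≤ m, ‖s j‖ ^ 2 < r ^ 2
    · rw [htel (m + 1) fun j hj => hm j (Nat.lt_succ_iff.1 hj)]
      have h1 : ‖s (m + 1)‖ ≤ r + ‖s (m + 1) - s m‖ := by
        have h2 : ‖s m‖ < r := lt_of_pow_lt_pow_left₀ 2 hr (hm m le_rfl)
        have h3 := norm_add_le (s m) (s (m + 1) - s m)
        rw [add_sub_cancel] at h3
        linarith
      have h4 : ‖s (m + 1)‖ ^ 2 ≤ (r + ‖s (m + 1) - s m‖) ^ 2 := by gcongr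
      have h5 := add_sq_le_of_pos (r := r) (x := ‖s (m + 1) - s m‖) hη
      have h6 : ‖s (m + 1) - s m‖ ^ 4 ≤ ∑ k ∈ Finset.range (m + 1), ‖s (k + 1) - s k‖ ^ 4 :=
        Finset.single_le_sum (f := fun k => ‖s (k + 1) - s k‖ ^ 4)
          (fun _ _ => by positivity) (Finset.self_mem_range_succ m)
      have h7 := mul_le_mul_of_nonneg_left h6 hc0
      have h8 : 0 ≤ ‖s 0‖ ^ 2 := by positivity
      linarith
    · rw [Finset.sum_range_succ, Finset.sum_range_succ, if_neg hm, zero_mul, add_zero]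
      have : 0 ≤ c * ‖s (m + 1) - s m‖ ^ 4 := by positivity
      linarith

open Classical in
-- Here `h` times the sum is a grid version of `x = min (n / Q) 3`, and `R ≥ √n * x ^ (-1/2) ≥ √n *
-- (3/2 - x/2)`. The horizon `3` is the zero of the tangent line, so the bound is trivial when no
-- grid time passes `n / Q`.
theorem sqrt_mul_le_of_sum_indicator {n h R : ℝ} (hn : 0 < n) (hh : 0 < h) (hR : 0 ≤ R) {N : ℕ}
    (hN : N * h = 3) {Q : ℝ≥0∞} (hQ : Q ≤ ENNReal.ofReal (R ^ 2)) :
    √n * (3 / 2 - h * (∑ k ∈ Finset.range N,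
      if ENNReal.ofReal (k * h) * Q < ENNReal.ofReal n then (1 : ℝ) else 0) / 2) ≤ R := by
  by_cases hall : ∀ k < N, ENNReal.ofReal (k * h) * Q < ENNReal.ofReal n
  · rw [Finset.sum_congr rfl fun k hk => if_pos (hall k (Finset.mem_range.1 hk))]
    simp only [Finset.sum_const, Finset.card_range, nsmul_eq_mul, mul_one]
    rw [mul_comm h, hN]
    simpa using hR
  · push Not at hall
    have hex : ∃ k, k < N ∧ ENNReal.ofReal n ≤ ENNReal.ofReal (k * h) * Q := hall
    obtain ⟨hk, hkQ⟩ := Nat.find_spec hex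
    set m := Nat.find hex with hm
    have hlt : ∀ j < m, ENNReal.ofReal (j * h) * Q < ENNReal.ofReal n := by
      intro j hj
      have := Nat.find_min hex hj
      push Not at this
      exact this (hj.trans hk)
    have h1 : (m : ℝ) ≤ ∑ k ∈ Finset.range N,
        if ENNReal.ofReal (k * h) * Q < ENNReal.ofReal n then (1 : ℝ) else 0 := by
      calc (m : ℝ) = ∑ k ∈ Finset.range m,
            if ENNReal.ofReal (k * h) * Q < ENNReal.ofReal n then (1 : ℝ) else 0 := by
            rw [Finset.sum_congr rfl fun k hk => if_pos (hlt k (Finset.mem_range.1 hk))]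
            simp
        _ ≤ _ := Finset.sum_le_sum_of_subset_of_nonneg (Finset.range_mono hk.le)
            fun _ _ _ => by split_ifs <;> simp
    have h2 : n ≤ m * h * R ^ 2 := by
      have : ENNReal.ofReal n ≤ ENNReal.ofReal (m * h * R ^ 2) := by
        rw [ENNReal.ofReal_mul (by positivity)]
        exact hkQ.trans (by gcongr)
      exact (ENNReal.ofReal_le_ofReal_iff (by positivity)).1 this
    set x := m * h with hx
    have hx0 : 0 ≤ x := by positivity
    have hx3 : x ≤ 3 := by
      rw [← hN, hx]
      have : (m : ℝ) ≤ N := by exact_mod_cast hk.le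
      gcongr
    have h3 : √n * (3 / 2 - h * (∑ k ∈ Finset.range N,
        if ENNReal.ofReal (k * h) * Q < ENNReal.ofReal n then (1 : ℝ) else 0) / 2) ≤
        √n * (3 / 2 - x / 2) := by
      gcongr
      rw [hx, mul_comm]
      gcongr
    refine h3.trans ?_
    refine abs_le_of_sq_le_sq' ?_ hR |>.2
    rw [mul_pow, Real.sq_sqrt hn.le]
    -- Comes from `4 - x * (3 - x) ^ 2 = (x - 1) ^ 2 * (4 - x)`.
    have h4 : (3 / 2 - x / 2) ^ 2 * x ≤ 1 := by
      nlinarith [mul_nonneg (sq_nonneg (x - 1)) (by linarith : 0 ≤ 4 - x)]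
    calc n * (3 / 2 - x / 2) ^ 2 ≤ (x * R ^ 2) * (3 / 2 - x / 2) ^ 2 := by gcongr
      _ = ((3 / 2 - x / 2) ^ 2 * x) * R ^ 2 := by ring
      _ ≤ 1 * R ^ 2 := by gcongr
      _ = _ := one_mul _

end Pathwise

/-! ### Exit from the ball of radius `√n` and the lower bound -/

namespace IsBrownianMotion

variable {Ω : Type*} {mΩ : MeasurableSpace Ω} {P : Measure Ω} {n : ℕ}
  {W : ℝ≥0 → Ω → EuclideanSpace ℝ (Fin n)}

theorem nullMeasurableSet_forall_norm_sq_lt (hW : IsBrownianMotion W P) (h : ℝ≥0) (k : ℕ) :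
    NullMeasurableSet {ω | ∀ j ≤ k, ‖W (j * h) ω‖ ^ 2 < (n : ℝ)} P := by
  have : {ω | ∀ j ≤ k, ‖W (j * h) ω‖ ^ 2 < (n : ℝ)} =
      ⋂ j : ℕ, ⋂ _ : j ≤ k, {ω | ‖W (j * h) ω‖ ^ 2 < (n : ℝ)} := by
    ext; simp
  rw [this]
  exact NullMeasurableSet.iInter fun j => NullMeasurableSet.iInter fun _ =>
    nullMeasurableSet_lt ((hW.aemeasurable _).norm.pow_const 2) aemeasurable_const

/-- Optional stopping at the exit from the ball of radius `√n`, along a grid of mesh `h`. -/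
theorem sum_measure_forall_norm_sq_lt_le [IsProbabilityMeasure P] (hW : IsBrownianMotion W P)
    (h : ℝ≥0) (N : ℕ) {η : ℝ} (hη : 0 < η) :
    n * h * ∑ k ∈ Finset.range N, P.real {ω | ∀ j ≤ k, ‖W (j * h) ω‖ ^ 2 < (n : ℝ)} ≤
      n + 2 * η + (n / η + 1) ^ 2 / (4 * η) *
        (N * (n ^ 2 * h ^ 2 * ∫ x, x ^ 4 ∂gaussianReal 0 1)) := by
  classical
  have hs : ∀ k : ℕ, ((k + 1 : ℕ) : ℝ≥0) * h = k * h + h := fun k => by push_cast; ring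
  have hterm : ∀ k : ℕ,
      Integrable (fun ω => (if ∀ j ≤ k, ‖W (j * h) ω‖ ^ 2 < (n : ℝ) then (1 : ℝ) else 0) *
        (‖W ((k + 1 : ℕ) * h) ω‖ ^ 2 - ‖W (k * h) ω‖ ^ 2)) P ∧
      ∫ ω, (if ∀ j ≤ k, ‖W (j * h) ω‖ ^ 2 < (n : ℝ) then (1 : ℝ) else 0) *
        (‖W ((k + 1 : ℕ) * h) ω‖ ^ 2 - ‖W (k * h) ω‖ ^ 2) ∂P =
        n * h * P.real {ω | ∀ j ≤ k, ‖W (j * h) ω‖ ^ 2 < (n : ℝ)} := by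
    intro k
    have hC : MeasurableSet {x : Fin n → Set.Iic k → ℝ | ∀ p, ∑ i, x i p ^ 2 < (n : ℝ)} := by
      have : {x : Fin n → Set.Iic k → ℝ | ∀ p, ∑ i, x i p ^ 2 < (n : ℝ)} =
          ⋂ p, {x : Fin n → Set.Iic k → ℝ | ∑ i, x i p ^ 2 < (n : ℝ)} := by ext; simp
      rw [this]
      exact MeasurableSet.iInter fun p => measurableSet_lt (by fun_prop) measurable_const
    have key := hW.integral_indicator_norm_sq_sub (k * h) h (fun p : Set.Iic k => (p : ℕ) * h)
      (fun p => mul_le_mul_left (Nat.cast_le.2 p.2) h) hC ⟨k, Set.self_mem_Iic⟩ rfl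
    have hind : ∀ ω, Set.indicator {x : Fin n → Set.Iic k → ℝ | ∀ p, ∑ i, x i p ^ 2 < (n : ℝ)}
        (fun _ => (1 : ℝ)) (fun j p => W ((p : ℕ) * h) ω j) =
        if ∀ j ≤ k, ‖W (j * h) ω‖ ^ 2 < (n : ℝ) then (1 : ℝ) else 0 := by
      intro ω
      rw [Set.indicator_apply]
      refine if_congr ?_ rfl rfl
      simp [EuclideanSpace.real_norm_sq_eq]
    simp_rw [hind] at key
    rw [hs k]
    refine ⟨key.1, key.2.trans ?_⟩
    congr 1
    have : (fun ω => if ∀ j ≤ k, ‖W (j * h) ω‖ ^ 2 < (n : ℝ) then (1 : ℝ) else 0) =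
        Set.indicator {ω | ∀ j ≤ k, ‖W (j * h) ω‖ ^ 2 < (n : ℝ)} (fun _ => (1 : ℝ)) := by
      ext ω; rw [Set.indicator_apply]; rfl
    rw [this, integral_indicator₀ (hW.nullMeasurableSet_forall_norm_sq_lt h k)]
    simp
  have hfour : ∀ k : ℕ, Integrable (fun ω => ‖W ((k + 1 : ℕ) * h) ω - W (k * h) ω‖ ^ 4) P ∧
      ∫ ω, ‖W ((k + 1 : ℕ) * h) ω - W (k * h) ω‖ ^ 4 ∂P ≤
        n ^ 2 * h ^ 2 * ∫ x, x ^ 4 ∂gaussianReal 0 1 := by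
    intro k
    rw [hs k]
    exact hW.integral_norm_increment_pow_four_le _ _
  have hpath : ∀ ω, ∑ k ∈ Finset.range N,
      (if ∀ j ≤ k, ‖W (j * h) ω‖ ^ 2 < (n : ℝ) then (1 : ℝ) else 0) *
        (‖W ((k + 1 : ℕ) * h) ω‖ ^ 2 - ‖W (k * h) ω‖ ^ 2) ≤
      (n + 2 * η) + (n / η + 1) ^ 2 / (4 * η) *
        ∑ k ∈ Finset.range N, ‖W ((k + 1 : ℕ) * h) ω - W (k * h) ω‖ ^ 4 := by
    intro ω
    have := sum_stopped_increments_le (fun k : ℕ => W (k * h) ω) (Real.sqrt_nonneg n) hη N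
    rw [Real.sq_sqrt (Nat.cast_nonneg n)] at this
    convert this
  have hint : Integrable (fun ω => ∑ k ∈ Finset.range N,
      ‖W ((k + 1 : ℕ) * h) ω - W (k * h) ω‖ ^ 4) P := integrable_finsetSum _ fun k _ => (hfour k).1
  have hmono := integral_mono (integrable_finsetSum _ fun k _ => (hterm k).1)
    ((integrable_const ((n : ℝ) + 2 * η)).add (hint.const_mul _)) hpath
  rw [integral_finsetSum _ fun k _ => (hterm k).1, Finset.sum_congr rfl fun k _ => (hterm k).2,
    ← Finset.mul_sum] at hmono
  refine hmono.trans ?_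
  simp only [Pi.add_apply]
  rw [integral_add (integrable_const _) (hint.const_mul _), integral_const_mul,
    integral_finsetSum _ fun k _ => (hfour k).1]
  simp only [integral_const, probReal_univ, one_smul]
  gcongr
  calc _ ≤ ∑ k ∈ Finset.range N, ((n : ℝ) ^ 2 * h ^ 2 * ∫ x, x ^ 4 ∂gaussianReal 0 1) :=
        Finset.sum_le_sum fun k _ => (hfour k).2
    _ = _ := by simp

/-- The supremum of the squared norm of a path over `[0, 1]`. -/
noncomputable def supNormSq (x : Fin n → ℕ × ℕ → ℝ) : ℝ≥0∞ :=
  ⨆ p, ENNReal.ofReal (∑ i, x i p ^ 2)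

theorem measurable_supNormSq : Measurable (supNormSq (n := n)) :=
  Measurable.iSup fun p => by fun_prop

theorem aemeasurable_path (hW : IsBrownianMotion W P) :
    AEMeasurable (fun ω (i : Fin n) p => W (unitTime p) ω i) P :=
  aemeasurable_pi_lambda _ fun i => aemeasurable_pi_lambda _ fun _ =>
    (hW.isBrownianReal_coord i).aemeasurable _

/-- By scaling, `k * h` times the squared supremum over `[0, 1]` has the law of the squared supremum
over `[0, k * h]`. The grid times `j * h` correspond to `j / k`, which are among the values of
`unitTime`. -/
theorem measure_supNormSq_lt_le [IsProbabilityMeasure P] (hn : 1 ≤ n) (hW : IsBrownianMotion W P)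
    {h : ℝ≥0} (hh : h ≠ 0) (k : ℕ) :
    P.real {ω | ENNReal.ofReal (k * h) * supNormSq (fun i p => W (unitTime p) ω i) <
      ENNReal.ofReal n} ≤ P.real {ω | ∀ j ≤ k, ‖W (j * h) ω‖ ^ 2 < (n : ℝ)} := by
  -- Time `0` cannot be rescaled; there the right side is `1`, since `W 0 = 0` almost surely and `n
  -- ≥ 1`.
  rcases Nat.eq_zero_or_pos k with rfl | hk
  · have h0 : ∀ᵐ ω ∂P, ∀ i, W 0 ω i = 0 :=
      ae_all_iff.2 fun i => (hW.isBrownianReal_coord i).eval_zero_ae_eq_zero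
    have h1 : P.real {ω | ∀ j ≤ 0, ‖W ((j : ℕ) * h) ω‖ ^ 2 < (n : ℝ)} = 1 := by
      rw [measureReal_def, (prob_compl_eq_zero_iff₀
        (hW.nullMeasurableSet_forall_norm_sq_lt h 0)).1, ENNReal.toReal_one]
      rw [← mem_ae_iff]
      filter_upwards [h0] with ω hω j hj
      obtain rfl := Nat.le_zero.1 hj
      rw [EuclideanSpace.real_norm_sq_eq]
      simp only [Nat.cast_zero, zero_mul, hω]
      simpa using Nat.lt_of_succ_le hn
    rw [h1]
    exact measureReal_le_one
  · have hc : (k : ℝ≥0) * h ≠ 0 := mul_ne_zero (by positivity) hh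
    have hV := hW.smul hc
    set V : ℝ≥0 → Ω → EuclideanSpace ℝ (Fin n) := fun t ω =>
      (√(((k : ℝ≥0) * h : ℝ≥0) : ℝ))⁻¹ • W ((k : ℝ≥0) * h * t) ω with hVdef
    have hD : MeasurableSet {x : Fin n → ℕ × ℕ → ℝ |
        ENNReal.ofReal (k * h) * supNormSq x < ENNReal.ofReal n} :=
      measurableSet_lt (measurable_supNormSq.const_mul _) measurable_const
    have heq : P {ω | ENNReal.ofReal (k * h) * supNormSq (fun i p => W (unitTime p) ω i) <
        ENNReal.ofReal n} = P {ω | ENNReal.ofReal (k * h) *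
        supNormSq (fun i p => V (unitTime p) ω i) < ENNReal.ofReal n} := by
      have h1 := Measure.map_apply_of_aemeasurable hW.aemeasurable_path hD
      have h2 := Measure.map_apply_of_aemeasurable hV.aemeasurable_path hD
      rw [hW.map_comp_eq hV unitTime] at h1
      exact h1.symm.trans h2
    rw [measureReal_def, heq, ← measureReal_def]
    refine measureReal_mono ?_
    intro ω hω j hj
    have hk' : (k : ℝ≥0) ≠ 0 := by positivity
    have ht : unitTime (j, k) = j * (k : ℝ≥0)⁻¹ := by
      refine min_eq_right ?_
      rw [← div_eq_mul_inv]
      exact div_le_one_of_le₀ (Nat.cast_le.2 hj) zero_le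
    have h1 : (k : ℝ≥0) * h * unitTime (j, k) = j * h := by
      rw [ht]
      calc (k : ℝ≥0) * h * (j * (k : ℝ≥0)⁻¹) = j * h * (k * (k : ℝ≥0)⁻¹) := by ring
        _ = j * h := by rw [mul_inv_cancel₀ hk', mul_one]
    have h2 : ENNReal.ofReal (∑ i, V (unitTime (j, k)) ω i ^ 2) ≤
        supNormSq (fun i p => V (unitTime p) ω i) :=
      le_iSup (fun p => ENNReal.ofReal (∑ i, V (unitTime p) ω i ^ 2)) (j, k)
    have hpos : (0 : ℝ) < k * h := by
      have : (0 : ℝ≥0) < k * h := pos_iff_ne_zero.2 hc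
      exact_mod_cast this
    have h3 : ENNReal.ofReal (k * h) * ENNReal.ofReal (∑ i, V (unitTime (j, k)) ω i ^ 2) <
        ENNReal.ofReal n := (mul_le_mul_right h2 _).trans_lt hω
    rw [← ENNReal.ofReal_mul hpos.le] at h3
    have h4 := (ENNReal.ofReal_lt_ofReal_iff (by exact_mod_cast hn)).1 h3
    rw [← EuclideanSpace.real_norm_sq_eq, hVdef] at h4
    simp only [h1] at h4
    rw [norm_smul, mul_pow, norm_inv, inv_pow, Real.norm_of_nonneg (Real.sqrt_nonneg _),
      Real.sq_sqrt (NNReal.coe_nonneg _)] at h4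
    push_cast at h4
    rwa [mul_inv_cancel_left₀ hpos.ne'] at h4

/-- Both the origin and `W t` lie in any ball that contains the path, so `‖W t‖` is at most its
diameter. -/
theorem ae_supNormSq_le (hW : IsBrownianMotion W P) :
    ∀ᵐ ω ∂P, supNormSq (fun i p => W (unitTime p) ω i) ≤
      ENNReal.ofReal ((2 * circumradius (pathHull W 1 ω)) ^ 2) := by
  have h0 : ∀ᵐ ω ∂P, ∀ i, W 0 ω i = 0 :=
    ae_all_iff.2 fun i => (hW.isBrownianReal_coord i).eval_zero_ae_eq_zero
  filter_upwards [h0, hW.ae_continuous] with ω hω hcont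
  have hW0 : W 0 ω = 0 := by ext i; exact hω i
  refine iSup_le fun p => ?_
  rw [← EuclideanSpace.real_norm_sq_eq (W (unitTime p) ω)]
  refine ENNReal.ofReal_le_ofReal ?_
  have h1 : ‖W (unitTime p) ω‖ / 2 ≤ circumradius (pathHull W 1 ω) := by
    refine le_csInf (exists_pathHull_subset_closedBall hcont) ?_
    rintro r ⟨hr, c, hc⟩
    rw [pathHull_subset_closedBall_iff] at hc
    have h2 := hc _ (unitTime_le_one p)
    have h3 := hc 0 zero_le
    rw [hW0, dist_comm] at h3
    have h4 := dist_triangle (W (unitTime p) ω) c 0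
    rw [dist_zero_right] at h4
    linarith
  have h2 : ‖W (unitTime p) ω‖ ≤ 2 * circumradius (pathHull W 1 ω) := by linarith
  gcongr

theorem grid_le_integral_circumradius [IsProbabilityMeasure P] (hn : 1 ≤ n)
    (hW : IsBrownianMotion W P) {N : ℕ} (hN : 0 < N) {η : ℝ} (hη : 0 < η) :
    √(n : ℝ) * (3 / 2 - (n + 2 * η + (n / η + 1) ^ 2 / (4 * η) *
      (n ^ 2 * 9 * ∫ x, x ^ 4 ∂gaussianReal 0 1) / N) / n / 2) ≤
      2 * ∫ ω, circumradius (pathHull W 1 ω) ∂P := by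
  classical
  have hn' : (0 : ℝ) < n := by exact_mod_cast hn
  have hN' : (0 : ℝ) < N := by exact_mod_cast hN
  set h : ℝ≥0 := 3 / N with hh
  have hhr : (h : ℝ) = 3 / N := by simp [hh]
  have hpos : (0 : ℝ) < h := by rw [hhr]; positivity
  have hh0 : h ≠ 0 := by
    intro h0; rw [h0] at hpos; simp at hpos
  have hNh : (N : ℝ) * h = 3 := by rw [hhr]; field_simp
  set A : ℕ → Set Ω := fun k => {ω | ENNReal.ofReal (k * h) *
    supNormSq (fun i p => W (unitTime p) ω i) < ENNReal.ofReal n} with hA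
  have hAm : ∀ k, NullMeasurableSet (A k) P := fun k =>
    nullMeasurableSet_lt ((measurable_supNormSq.comp_aemeasurable
      hW.aemeasurable_path).const_mul _) aemeasurable_const
  have hAint : ∀ k, Integrable ((A k).indicator fun _ => (1 : ℝ)) P := fun k =>
    (integrable_const (1 : ℝ)).indicator₀ (hAm k)
  have hAi : ∀ k, ∫ ω, (A k).indicator (fun _ => (1 : ℝ)) ω ∂P = P.real (A k) := fun k => by
    rw [integral_indicator₀ (hAm k)]; simp
  have hpath : ∀ᵐ ω ∂P, √(n : ℝ) * (3 / 2 - h * (∑ k ∈ Finset.range N,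
      (A k).indicator (fun _ => (1 : ℝ)) ω) / 2) ≤ 2 * circumradius (pathHull W 1 ω) := by
    filter_upwards [hW.ae_supNormSq_le] with ω hω
    have := sqrt_mul_le_of_sum_indicator hn' hpos
      (mul_nonneg zero_le_two (circumradius_nonneg (pathHull W 1 ω))) hNh hω
    convert this using 6 with k
    rw [Set.indicator_apply]
    rfl
  have hsum : Integrable (fun ω => ∑ k ∈ Finset.range N,
      (A k).indicator (fun _ => (1 : ℝ)) ω) P := integrable_finsetSum _ fun k _ => hAint k
  have hRint : Integrable (fun ω => circumradius (pathHull W 1 ω)) P :=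
    hW.memLp_circumradius.integrable (by norm_num)
  have h1 := integral_mono_ae (((integrable_const (3 / 2 : ℝ)).sub
    ((hsum.const_mul (h : ℝ)).div_const 2)).const_mul √(n : ℝ)) (hRint.const_mul 2) hpath
  simp only [Pi.sub_apply] at h1
  rw [integral_const_mul, integral_const_mul, integral_sub (integrable_const _)
    ((hsum.const_mul (h : ℝ)).div_const 2), integral_div, integral_div, integral_const_mul,
    integral_finsetSum _ fun k _ => hAint k, Finset.sum_congr rfl fun k _ => hAi k] at h1
  simp only [integral_const, probReal_univ, one_smul] at h1
  refine le_trans ?_ h1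
  have h2 : ∑ k ∈ Finset.range N, P.real (A k) ≤ ∑ k ∈ Finset.range N,
      P.real {ω | ∀ j ≤ k, ‖W (j * h) ω‖ ^ 2 < (n : ℝ)} :=
    Finset.sum_le_sum fun k _ => hW.measure_supNormSq_lt_le hn hh0 k
  have h3 := hW.sum_measure_forall_norm_sq_lt_le h N hη
  have h4 : (N : ℝ) * (n ^ 2 * h ^ 2 * ∫ x, x ^ 4 ∂gaussianReal 0 1) =
      (n ^ 2 * 9 * ∫ x, x ^ 4 ∂gaussianReal 0 1) / N := by
    rw [hhr]; field_simp; ring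
  rw [h4, ← mul_div_assoc] at h3
  have h5 : h * ∑ k ∈ Finset.range N, P.real (A k) ≤ (n + 2 * η + (n / η + 1) ^ 2 / (4 * η) *
      (n ^ 2 * 9 * ∫ x, x ^ 4 ∂gaussianReal 0 1) / N) / n := by
    rw [le_div_iff₀ hn']
    refine le_trans ?_ h3
    calc _ = n * h * ∑ k ∈ Finset.range N, P.real (A k) := by ring
      _ ≤ _ := by gcongr
  gcongr

/-- First `N → ∞` for fixed `η`, then `η → 0`; the order matters because the fourth-moment
coefficient blows up as `η → 0`. The limit `3/2 - 1/2 = 1` leaves `√n ≤ 2 * E[R₁]`. -/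
theorem le_integral_circumradius [IsProbabilityMeasure P] (hn : 1 ≤ n)
    (hW : IsBrownianMotion W P) :
    (1 / 2 : ℝ) * √(n : ℝ) ≤ ∫ ω, circumradius (pathHull W 1 ω) ∂P := by
  have hn' : (0 : ℝ) < n := by exact_mod_cast hn
  have h1 : ∀ η : ℝ, 0 < η → √(n : ℝ) * (3 / 2 - (n + 2 * η + 0) / n / 2) ≤
      2 * ∫ ω, circumradius (pathHull W 1 ω) ∂P := by
    intro η hη
    have ht : Filter.Tendsto (fun N : ℕ => √(n : ℝ) * (3 / 2 - (n + 2 * η +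
        (n / η + 1) ^ 2 / (4 * η) * (n ^ 2 * 9 * ∫ x, x ^ 4 ∂gaussianReal 0 1) / N) / n / 2))
        Filter.atTop (nhds (√(n : ℝ) * (3 / 2 - (n + 2 * η + 0) / n / 2))) :=
      ((((tendsto_const_div_atTop_nhds_zero_nat _).const_add _).div_const _).div_const _
        |>.const_sub _).const_mul _
    refine le_of_tendsto ht ?_
    filter_upwards [Filter.eventually_gt_atTop 0] with N hN
    exact hW.grid_le_integral_circumradius hn hN hη
  have h2 : Filter.Tendsto (fun η : ℝ => √(n : ℝ) * (3 / 2 - (n + 2 * η + 0) / n / 2))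
      (nhdsWithin 0 (Set.Ioi 0)) (nhds (√(n : ℝ) * (3 / 2 - (n + 2 * 0 + 0) / n / 2))) := by
    have hc : Continuous fun η : ℝ => √(n : ℝ) * (3 / 2 - (n + 2 * η + 0) / n / 2) := by fun_prop
    exact (hc.tendsto 0).mono_left nhdsWithin_le_nhds
  have h3 := le_of_tendsto h2 (Filter.eventually_of_mem self_mem_nhdsWithin h1)
  have h4 : √(n : ℝ) * (3 / 2 - (n + 2 * 0 + 0) / n / 2) = √(n : ℝ) := by
    field_simp; ring
  rw [h4] at h3
  linarith

end IsBrownianMotion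

theorem theorem5 {Ω : Type*} [MeasurableSpace Ω] (P : Measure Ω) [IsProbabilityMeasure P]
    (n : ℕ) (hn : 1 ≤ n) (W : ℝ≥0 → Ω → EuclideanSpace ℝ (Fin n)) (hW : IsBrownianMotion W P) :
    Integrable (fun ω => circumradius (pathHull W 1 ω)) P ∧
      (1 / 2 : ℝ) * √(n : ℝ) ≤ ∫ ω, circumradius (pathHull W 1 ω) ∂P ∧
      ∫ ω, circumradius (pathHull W 1 ω) ∂P ≤ √(Real.log 2) * √(n : ℝ) := by
  exact ⟨hW.memLp_circumradius.integrable (by norm_num), hW.le_integral_circumradius hn,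
    hW.integral_circumradius_le hn⟩
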